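/- **Conventions.** Let $H$ be a complex Hilbert space. For a linear map $A:H\to K$ into a Hilbert space let $\|A\|_{HS}^2=\sup_{F}\sum_{v\in F}\|Av\|^2\in[0,\infty]$, the supremum over finite orthonormal families $F$ in $H$ (for bounded $A$ this is $\sum_i\|Ae_i\|^2$ for any orthonormal basis $(e_i)$). Let $L^2_h(H)$ be the real Hilbert space of self-adjoint Hilbert–Schmidt operators on $H$, and let a *form* be a map $\mathcal E$ from operators on $H$ to $[0,\infty]$, with domain $\mathrm{Dom}(\mathcal E)=\{x\in L^2_h(H):\mathcal E(x)<\infty\}$. The form $\mathcal E$ is *closed* if, whenever $x_k\in\mathrm{Dom}(\mathcal E)$, $x\in L_h^2(H)$, $\|x_k-x\|_{HS}\to0$ and $\mathcal E(x_k-x_l)\to 0$ as $k,l\to\infty$, one has $x\in\mathrm{Dom}(\mathcal E)$ and $\mathcal E(x_k-x)\to0$. It is *Dirichlet* if it is quadratic (real homogeneity of degree 2 and the parallelogram identity on $L^2_h(H)$), closed, densely defined in $L^2_h(H)$, and for all Lipschitz $f:\mathbb R\to\mathbb R$ with $f(0)=0$ and all $x\in\mathrm{Dom}(\mathcal E)$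 one has $f(x)\in\mathrm{Dom}(\mathcal E)$ and $\mathcal E(f(x))\le\|f\|_{\mathrm{lip}}^2\,\mathcal E(x)$. It is *completely Dirichlet* if for every $m\in\mathbb N$ the form $\mathcal E\otimes 1_m$ on operators on $H^m$, $(\mathcal E\otimes1_m)\big((x_{ij})\big)=\sum_{i,j}\big(\mathcal E(\mathrm{Re}\,x_{ij})+\mathcal E(\mathrm{Im}\,x_{ij})\big)$, is Dirichlet, where $\mathrm{Re}\,y=\frac{y+y^*}2$ and $\mathrm{Im}\,y=\frac{y-y^*}{2i}$. For a densely defined linear operator $S:\mathrm{Dom}(S)\subset H\to K$ between complex Hilbert spaces, the form of $T=S^*S$ is $\mathcal E_T(x)=\|Sx\|_{HS}^2$ (that is, $\mathrm{Tr}(xTx)$) if $x(H)\subset\mathrm{Dom}(S)$, and $\mathcal E_T(x)=\infty$ otherwise. **Statement.** Let $X$ be a compact smooth Riemannian manifold without boundary and $E\to X$ a smooth complex vector bundle of finite rank with a smooth hermitian metric and a smooth, complex linear, metric-compatible connection $\nabla$. Let $L^2(E)$ and $L^2(T^*X\otimes E)$ be the $L^2$ spaces for the Riemannian volume (the completions of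 the spaces of smooth sections). 1. Let $\bar\nabla:L^2(E)\to L^2(T^*X\otimes E)$ be the closure of $\nabla$ on smooth sections, and let $\mathcal E_\Delta(x)=\|\bar\nabla x\|_{HS}^2$ be the quadratic form of the connection laplacian $\Delta_E=\nabla^*\nabla$ on the Hilbert–Schmidt operators on $L^2(E)$. If $\mathcal E_\Delta$ is closed, then it is Dirichlet and completely Dirichlet. 2. Suppose in addition that $E$ with $\nabla$ is a Dirac bundle (for example, the spinor bundle, or a twisted spinor bundle, of a spin manifold $X$): there is a smooth, complex linear Clifford multiplication $c:TX\to\mathrm{End}(E)$ with $c(v)^2=-\|v\|^2$, with $c(v)$ skew-hermitian, and with $\nabla_u(c(Y)s)=c(\nabla^{LC}_uY)s+c(Y)\nabla_us$. Let $\bar D$ be the closure in $L^2(E)$ of the Dirac operator $Ds=\sum_ic(e_i)\nabla_{e_i}s$ on smooth sections, and let $\mathcal E_{D^2}(x)=\|\bar Dx\|_{HS}^2$ be the quadratic form of the Dirac laplacian $D^2$. If $\mathcal E_{D^2}$ is closed, then it is Dirichlet and completely Dirichlet. 3. Let $S$ be any densely defined operator between complex Hilbert spaces $H$ and $K$, and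 $T=S^*S$. If $\mathcal E_T$ is closed, then it is Dirichlet and completely Dirichlet. -/

import Mathlib

open scoped ENNReal NNReal ComplexStarModule InnerProductSpace Manifold ContDiff Bundle Topology
open MeasureTheory Bundle CovariantDerivative Manifold Filter

set_option linter.unusedSectionVars false
set_option linter.unusedSimpArgs false

noncomputable section

section hilbertSchmidt

variable {H K : Type*} [NormedAddCommGroup H] [InnerProductSpace ℂ H]
  [NormedAddCommGroup K] [InnerProductSpace ℂ K]

/-- The squared Hilbert–Schmidt norm `∑ ‖A e_i‖²` in `[0, ∞]`, as the supremum of `∑ ‖A v‖²` over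
all finite orthonormal families. For bounded `A` this is the sum over any orthonormal basis; for
unbounded `A` it is `∞`. -/
def hsNormSq (A : H →ₗ[ℂ] K) : ℝ≥0∞ :=
  ⨆ (s : Finset H) (_ : Orthonormal ℂ ((↑) : s → H)), ∑ v ∈ s, ‖A v‖ₑ ^ 2

/-- The quadratic form of `T = S* S` on operators, `x ↦ Tr (x T x) = ‖S x‖²` (Hilbert–Schmidt norm)
for self-adjoint `x`. It is `∞` when `x` does not map into the domain of `S`. -/
def hsForm (S : H →ₗ.[ℂ] K) (x : H →L[ℂ] H) : ℝ≥0∞ :=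
  open Classical in
  if h : ∀ v, x v ∈ S.domain then
    hsNormSq (S.toFun ∘ₗ (x : H →ₗ[ℂ] H).codRestrict S.domain h)
  else ⊤

end hilbertSchmidt

section dirichlet

variable {H : Type*} [NormedAddCommGroup H] [InnerProductSpace ℂ H] [CompleteSpace H]

variable (H) in
/-- The self-adjoint Hilbert–Schmidt operators, i.e. the self-adjoint part of `L²(B(H), Tr)`. -/
def L2h : Set (H →L[ℂ] H) := {x | IsSelfAdjoint x ∧ hsNormSq (x : H →ₗ[ℂ] H) < ⊤}

/-- The domain of a `[0, ∞]`-valued form on `L2h H`. -/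
def formDomain (E : (H →L[ℂ] H) → ℝ≥0∞) : Set (H →L[ℂ] H) := {x | x ∈ L2h H ∧ E x < ⊤}

/-- `E` is a quadratic form on `L2h H`. -/
structure IsQuadraticForm (E : (H →L[ℂ] H) → ℝ≥0∞) : Prop where
  smul : ∀ x ∈ L2h H, ∀ r : ℝ, E ((r : ℂ) • x) = ENNReal.ofReal (r ^ 2) * E x
  parallelogram : ∀ x ∈ L2h H, ∀ y ∈ L2h H, E (x + y) + E (x - y) = 2 * E x + 2 * E y

/-- `E` is closed: its domain is complete for the norm `(‖x‖²_HS + E x)^{1/2}`, that is, an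
`E`-Cauchy sequence in the domain which converges in Hilbert–Schmidt norm converges for `E` to an
element of the domain. -/
def IsClosedForm (E : (H →L[ℂ] H) → ℝ≥0∞) : Prop :=
  ∀ (u : ℕ → H →L[ℂ] H) (x : H →L[ℂ] H), (∀ k, u k ∈ formDomain E) → x ∈ L2h H →
    Tendsto (fun k => hsNormSq ((u k - x : H →L[ℂ] H) : H →ₗ[ℂ] H)) atTop (𝓝 0) →
    Tendsto (fun p : ℕ × ℕ => E (u p.1 - u p.2)) atTop (𝓝 0) →
    x ∈ formDomain E ∧ Tendsto (fun k => E (u k - x)) atTop (𝓝 0)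

/-- `E` is a Dirichlet form on `L2h H`: a closed, densely defined quadratic form whose domain is
invariant under the functional calculus of Lipschitz functions `f : ℝ → ℝ` with `f 0 = 0`, and
`E (f x) ≤ ‖f‖_lip² E x`. -/
structure IsDirichletForm (E : (H →L[ℂ] H) → ℝ≥0∞) : Prop where
  quadratic : IsQuadraticForm E
  closed : IsClosedForm E
  dense : ∀ x ∈ L2h H, ∀ ε > 0, ∃ y ∈ formDomain E,
    hsNormSq ((x - y : H →L[ℂ] H) : H →ₗ[ℂ] H) < ε
  contraction : ∀ (f : ℝ → ℝ) (C : ℝ≥0), LipschitzWith C f → f 0 = 0 → ∀ x ∈ formDomain E,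
    cfc f x ∈ formDomain E ∧ E (cfc f x) ≤ (C : ℝ≥0∞) ^ 2 * E x

variable (H) in
/-- `Hᵐ`, so that `B(Hᵐ) = B(H) ⊗ Mat_m`. -/
abbrev AmplSpace (m : ℕ) : Type _ := PiLp 2 fun _ : Fin m => H

/-- The matrix entry `x_ij` of an operator on `Hᵐ`. -/
def amplEntry {m : ℕ} (x : AmplSpace H m →L[ℂ] AmplSpace H m) (i j : Fin m) : H →L[ℂ] H :=
  PiLp.proj 2 (fun _ : Fin m => H) i ∘L x ∘L
    (PiLp.continuousLinearEquiv 2 ℂ fun _ : Fin m => H).symm.toContinuousLinearMap ∘L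
      ContinuousLinearMap.single ℂ (fun _ : Fin m => H) j

/-- `E ⊗ 1_m` on `L²(B(H), Tr) ⊗ Mat_m`, `x ↦ ∑ E (x_ij)`, where `E` is extended from self-adjoint
to all operators as a hermitian form, `E (a + i b) = E a + E b` for self-adjoint `a`, `b`. -/
def amplForm (E : (H →L[ℂ] H) → ℝ≥0∞) (m : ℕ) (x : AmplSpace H m →L[ℂ] AmplSpace H m) : ℝ≥0∞ :=
  ∑ i, ∑ j, (E (ℜ (amplEntry x i j)) + E (ℑ (amplEntry x i j)))

/-- `E` is completely Dirichlet if `E ⊗ 1_m` is Dirichlet for every `m`. -/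
def IsCompletelyDirichletForm (E : (H →L[ℂ] H) → ℝ≥0∞) : Prop :=
  ∀ m : ℕ, IsDirichletForm (amplForm E m)

end dirichlet

section contraction

theorem sum_orthonormalBasis_eq {T W ι κ : Type*} [NormedAddCommGroup T] [InnerProductSpace ℝ T]
    [AddCommGroup W] [Module ℝ W] [Fintype ι] [DecidableEq ι] [Fintype κ]
    (B : T →ₗ[ℝ] T →ₗ[ℝ] W) (e : OrthonormalBasis κ ℝ T) (b : Module.Basis ι ℝ T) :
    ∑ i, B (e i) (e i) = ∑ j, ∑ k, (Matrix.of fun j k => ⟪b j, b k⟫_ℝ)⁻¹ j k • B (b j) (b k) := by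
  classical
  set P : Matrix κ ι ℝ := Matrix.of fun i j => b.repr (e i) j with hP
  set Q : Matrix ι κ ℝ := Matrix.of fun j i => ⟪b j, e i⟫_ℝ with hQ
  have hG : (Matrix.of fun j k => ⟪b j, b k⟫_ℝ) = Q * Q.transpose := by
    ext j k
    simp only [hQ, Matrix.of_apply, Matrix.mul_apply, Matrix.transpose_apply]
    rw [← OrthonormalBasis.sum_inner_mul_inner e (b j) (b k)]
    exact Finset.sum_congr rfl fun i _ => by rw [real_inner_comm (b k)]
  have he : ∀ i, e i = ∑ j, P i j • b j := fun i => (b.sum_repr (e i)).symm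
  have hQP : Q * P = 1 := by
    ext j k
    simp only [hQ, hP, Matrix.of_apply, Matrix.mul_apply]
    have h := congrArg (fun v => b.repr v k) (e.sum_repr' (b j))
    simp only [map_sum, map_smul, Finsupp.coe_finsetSum, Finset.sum_apply, Finsupp.smul_apply,
      smul_eq_mul, Module.Basis.repr_self] at h
    rw [Matrix.one_apply]
    rw [Finsupp.single_apply] at h
    rw [← h]
    exact Finset.sum_congr rfl fun i _ => by rw [real_inner_comm]
  have hPQ : P * Q = 1 := by
    ext i k
    simp only [hQ, hP, Matrix.of_apply, Matrix.mul_apply]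
    have h := congrArg (fun v => ⟪v, e k⟫_ℝ) (b.sum_repr (e i))
    simp only [sum_inner, real_inner_smul_left] at h
    rw [h, OrthonormalBasis.inner_eq_ite, Matrix.one_apply]
  have hinv : (Matrix.of fun j k => ⟪b j, b k⟫_ℝ)⁻¹ = P.transpose * P := by
    apply Matrix.inv_eq_left_inv
    rw [hG, Matrix.mul_assoc, ← Matrix.mul_assoc P, hPQ, Matrix.one_mul, ← Matrix.transpose_mul, hQP,
      Matrix.transpose_one]
  rw [hinv]
  have : ∀ i, B (e i) (e i) = ∑ j, ∑ k, (P i j * P i k) • B (b j) (b k) := by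
    intro i
    conv_lhs => rw [he i]
    simp only [map_sum, map_smul, LinearMap.sum_apply, LinearMap.smul_apply, Finset.smul_sum, smul_smul]
    rw [Finset.sum_comm]
    exact Finset.sum_congr rfl fun j _ => Finset.sum_congr rfl fun k _ => by rw [mul_comm]
  simp only [this, Matrix.mul_apply, Matrix.transpose_apply, Finset.sum_smul]
  rw [Finset.sum_comm]
  refine Finset.sum_congr rfl fun j _ => ?_
  rw [Finset.sum_comm]

theorem gram_det_ne_zero {T ι : Type*} [NormedAddCommGroup T] [InnerProductSpace ℝ T]
    [Fintype ι] [DecidableEq ι] (b : Module.Basis ι ℝ T) :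
    (Matrix.of fun j k => ⟪b j, b k⟫_ℝ).det ≠ 0 := by
  have := (Matrix.posDef_gram_of_linearIndependent (𝕜 := ℝ) b.linearIndependent).det_pos
  exact this.ne'

theorem contDiffAt_inv_entry {ι : Type*} [Fintype ι] [DecidableEq ι] (A : ι → ι → ℝ)
    (hA : (Matrix.of A).det ≠ 0) (j k : ι) :
    ContDiffAt ℝ ∞ (fun A : ι → ι → ℝ => (Matrix.of A)⁻¹ j k) A := by
  have h1 : ContDiff ℝ ∞ fun A : ι → ι → ℝ => (Matrix.of A).det := by
    simp only [Matrix.det_apply, Matrix.of_apply]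
    fun_prop
  have h2 : ContDiff ℝ ∞ fun A : ι → ι → ℝ => (Matrix.of A).adjugate j k := by
    simp only [Matrix.adjugate_apply, Matrix.det_apply, Matrix.updateRow_apply, Matrix.of_apply]
    refine ContDiff.sum fun σ _ => ContDiff.const_smul _ (contDiff_prod fun i _ => ?_)
    split_ifs <;> fun_prop
  simp only [Matrix.inv_def, Matrix.smul_apply, smul_eq_mul, Ring.inverse_eq_inv']
  exact (h1.contDiffAt.inv hA).mul h2.contDiffAt

end contraction
section
variable {E : Type*} [NormedAddCommGroup E] [NormedSpace ℝ E] {H : Type*} [TopologicalSpace H]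
  {I : ModelWithCorners ℝ E H} [I.Boundaryless] {M : Type*} [EMetricSpace M] [ChartedSpace H M]
  [RiemannianBundle (fun x : M => TangentSpace I x)] [IsManifold I 1 M]
  [IsContinuousRiemannianBundle E (fun x : M => TangentSpace I x)] [IsRiemannianManifold I M]

open Metric Set
attribute [local instance] normedAddCommGroupTangentSpaceVectorSpace normedSpaceTangentSpaceVectorSpace
variable (I) in
theorem exists_lipschitzOnWith_extChartAt_symm (x : M) :
    ∃ C : ℝ≥0, ∃ r > 0, ball (extChartAt I x x) r ⊆ (extChartAt I x).target ∧
      LipschitzOnWith C (extChartAt I x).symm (ball (extChartAt I x x) r) := by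
  rcases eventually_enorm_mfderivWithin_symm_extChartAt_lt I x with ⟨C, C_pos, hC⟩
  obtain ⟨r, r_pos, hr⟩ :=
    mem_nhdsWithin_iff.1 (Filter.inter_mem (extChartAt_target_mem_nhdsWithin x) hC)
  have hr' := fun y hy => @hr y ⟨hy, by simp [I.range_eq_univ]⟩
  refine ⟨C, r, r_pos, fun y hy => (hr' y hy).1, fun y hy z hz => ?_⟩
  rw [IsRiemannianManifold.out (I := I)]
  let η := ContinuousAffineMap.lineMap (R := ℝ) y z
  set γ := (extChartAt I x).symm ∘ η
  have hηb : ∀ t ∈ Icc (0 : ℝ) 1, η t ∈ ball (extChartAt I x x) r := by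
    intro t ht
    refine (convex_ball _ _).segment_subset hy hz ?_
    rw [segment_eq_image_lineMap]
    exact ⟨t, ht, by simp [η, ContinuousAffineMap.coe_lineMap_eq]⟩
  have hη1 : Icc (0 : ℝ) 1 ⊆ η ⁻¹' (extChartAt I x).target := fun t ht => (hr' _ (hηb t ht)).1
  have η_smooth : CMDiff[Icc 0 1] 1 η := by
    apply ContMDiff.contMDiffOn
    rw [contMDiff_iff_contDiff]
    exact ContinuousAffineMap.contDiff _
  have : riemannianEDist I ((extChartAt I x).symm y) ((extChartAt I x).symm z)
      ≤ pathELength I γ 0 1 := by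
    apply riemannianEDist_le_pathELength _ _ _ zero_le_one
    · exact (contMDiffOn_extChartAt_symm x).comp η_smooth hη1
    · simp [γ, η, ContinuousAffineMap.coe_lineMap_eq]
    · simp [γ, η, ContinuousAffineMap.coe_lineMap_eq]
  apply this.trans
  rw [← lintegral_fderiv_lineMap_eq_edist, pathELength_eq_lintegral_mfderivWithin_Icc,
    ← lintegral_const_mul' _ _ ENNReal.coe_ne_top]
  apply setLIntegral_mono' measurableSet_Icc (fun t ht ↦ ?_)
  have : mfderiv[Icc 0 1] γ t =
      (mfderiv[Set.range I] (extChartAt I x).symm (η t)) ∘L (mfderiv[Icc 0 1] η t) := by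
    apply mfderivWithin_comp
    · exact mdifferentiableWithinAt_extChartAt_symm (hη1 ht)
    · exact η_smooth.mdifferentiableOn one_ne_zero t ht
    · exact hη1.trans (preimage_mono (extChartAt_target_subset_range x))
    · rw [uniqueMDiffWithinAt_iff_uniqueDiffWithinAt]
      exact uniqueDiffOn_Icc zero_lt_one t ht
  have : mfderiv[Icc 0 1] γ t 1 =
      (mfderiv[Set.range I] (extChartAt I x).symm (η t)) (mfderiv[Icc 0 1] η t 1) := congr($this 1)
  rw [this]
  apply (ContinuousLinearMap.le_opENorm _ _).trans
  gcongr
  · exact (hr' _ (hηb t ht)).2.le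
  · simp only [mfderivWithin_eq_fderivWithin]
    exact le_of_eq rfl
end

section
variable {n : ℕ} {X : Type*} [EMetricSpace X]
  [ChartedSpace (EuclideanSpace ℝ (Fin n)) X] [IsManifold (𝓡 n) ∞ X]
  [RiemannianBundle (fun x : X => TangentSpace (𝓡 n) x)]
  [IsContMDiffRiemannianBundle (𝓡 n) ∞ (EuclideanSpace ℝ (Fin n)) (fun x : X => TangentSpace (𝓡 n) x)]

instance instRiemannianBundleTangentOne : IsContMDiffRiemannianBundle (𝓡 n) 1 (EuclideanSpace ℝ (Fin n)) fun x : X => TangentSpace (𝓡 n) x := IsContMDiffRiemannianBundle.of_le (n := ∞) (by simp)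


instance instIsContinuousRiemannianBundleTangent : IsContinuousRiemannianBundle (EuclideanSpace ℝ (Fin n)) fun x : X => TangentSpace (𝓡 n) x := by
  obtain ⟨g, hg, h⟩ := IsContMDiffRiemannianBundle.exists_contMDiff (IB := 𝓡 n) (n := ∞)
    (F := EuclideanSpace ℝ (Fin n)) (E := fun x : X => TangentSpace (𝓡 n) x)
  exact ⟨g, hg.continuous, h⟩
instance (x : X) : FiniteDimensional ℝ (TangentSpace (𝓡 n) x) :=
  inferInstanceAs (FiniteDimensional ℝ (EuclideanSpace ℝ (Fin n)))

variable (n) in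
/-- An orthonormal basis of the tangent space at `x`. -/
def tangentONB (x : X) :
    OrthonormalBasis (Fin (Module.finrank ℝ (TangentSpace (𝓡 n) x))) ℝ (TangentSpace (𝓡 n) x) :=
  stdOrthonormalBasis ℝ (TangentSpace (𝓡 n) x)

/-- Near each point the trace of a bilinear form on the tangent spaces over an orthonormal basis is
given by a smooth frame and smooth coefficients. -/
theorem exists_contraction (x₀ : X) :
    ∃ (b : Fin n → Π x : X, TangentSpace (𝓡 n) x) (g : Fin n → Fin n → X → ℝ),
      (∀ j, ContMDiffAt (𝓡 n) ((𝓡 n).prod 𝓘(ℝ, EuclideanSpace ℝ (Fin n))) ∞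
        (fun x => TotalSpace.mk' (EuclideanSpace ℝ (Fin n)) x (b j x)) x₀) ∧
      (∀ j k, ContMDiffAt (𝓡 n) 𝓘(ℝ) ∞ (g j k) x₀) ∧
      ∀ᶠ x in 𝓝 x₀, ∀ {W : Type*} [AddCommGroup W] [Module ℝ W]
        (B : TangentSpace (𝓡 n) x →ₗ[ℝ] TangentSpace (𝓡 n) x →ₗ[ℝ] W),
        ∑ i, B (tangentONB n x i) (tangentONB n x i) = ∑ j, ∑ k, g j k x • B (b j x) (b k x) := by
  set e := trivializationAt (EuclideanSpace ℝ (Fin n)) (fun x : X => TangentSpace (𝓡 n) x) x₀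
  let b₀ : Module.Basis (Fin n) ℝ (EuclideanSpace ℝ (Fin n)) :=
    (EuclideanSpace.basisFun (Fin n) ℝ).toBasis
  have hx₀ : x₀ ∈ e.baseSet := mem_baseSet_trivializationAt _ _ x₀
  have hb : ∀ j, ContMDiffAt (𝓡 n) ((𝓡 n).prod 𝓘(ℝ, EuclideanSpace ℝ (Fin n))) ∞
        (fun x => TotalSpace.mk' (EuclideanSpace ℝ (Fin n)) x (e.localFrame b₀ j x)) x₀ :=
    fun j => contMDiffAt_localFrame_of_mem (I := 𝓡 n) ∞ e b₀ j hx₀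
  refine ⟨e.localFrame b₀, fun j k x => (Matrix.of fun j k =>
    ⟪e.localFrame b₀ j x, e.localFrame b₀ k x⟫_ℝ)⁻¹ j k, hb, fun j k => ?_, ?_⟩
  · have h1 : ContMDiffAt (𝓡 n) 𝓘(ℝ, Fin n → Fin n → ℝ) ∞ (fun x : X => fun j k =>
        ⟪e.localFrame b₀ j x, e.localFrame b₀ k x⟫_ℝ) x₀ := by
      rw [contMDiffAt_pi_space]; intro j
      rw [contMDiffAt_pi_space]; intro k
      exact (hb j).inner_bundle (hb k)
    have h2 := contDiffAt_inv_entry (fun j k =>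
        ⟪e.localFrame b₀ j x₀, e.localFrame b₀ k x₀⟫_ℝ) (by
          have := gram_det_ne_zero (e.basisAt b₀ hx₀)
          simpa [hx₀] using this) j k
    exact h2.contMDiffAt.comp x₀ h1
  · filter_upwards [e.open_baseSet.mem_nhds hx₀] with x hx W _ _ B
    rw [sum_orthonormalBasis_eq B (tangentONB n x) (e.basisAt b₀ hx)]
    simp [hx]


variable [IsRiemannianManifold (𝓡 n) X] 

open Metric Set
variable [MeasurableSpace X] [BorelSpace X]

/-- The Riemannian volume of a compact Riemannian `n`-manifold, i.e. the normalized `n`-dimensional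
Hausdorff measure of its distance, is finite. -/
theorem isFiniteMeasure_riemannianVolume [CompactSpace X] :
    IsFiniteMeasure (μHE[n] : Measure X) := by
  have : IsLocallyFiniteMeasure (μHE[n] : Measure X) := by
    constructor
    intro x
    obtain ⟨C, r, hr, hsub, hL⟩ := exists_lipschitzOnWith_extChartAt_symm (𝓡 n) x
    refine ⟨(extChartAt (𝓡 n) x).symm '' ball (extChartAt (𝓡 n) x x) r, ?_, ?_⟩
    · have h1 : (extChartAt (𝓡 n) x) ⁻¹' (ball (extChartAt (𝓡 n) x x) r) ∈ 𝓝 x :=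
        (continuousAt_extChartAt x).preimage_mem_nhds (ball_mem_nhds _ hr)
      filter_upwards [h1, extChartAt_source_mem_nhds (I := 𝓡 n) x] with y hy hy'
      exact ⟨_, hy, (extChartAt (𝓡 n) x).left_inv hy'⟩
    · rw [Measure.euclideanHausdorffMeasure_def, Measure.smul_apply]
      refine ENNReal.mul_lt_top (by simp) ((hL.hausdorffMeasure_image_le (by positivity)).trans_lt ?_)
      refine ENNReal.mul_lt_top (ENNReal.rpow_lt_top_of_nonneg (by positivity) (by simp)) ?_
      exact measure_ball_lt_top
  exact ⟨isCompact_univ.measure_lt_top⟩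

end

attribute [local instance 50] InnerProductSpace.complexToReal

section completion

/-- `P` with the seminorm of a given (semi)inner product. -/
def PreL2 (P : Type*) [AddCommGroup P] [Module ℂ P] (_ : PreInnerProductSpace.Core ℂ P) :
    Type _ := P

variable {P : Type*} [AddCommGroup P] [Module ℂ P] (c : PreInnerProductSpace.Core ℂ P)

instance : SeminormedAddCommGroup (PreL2 P c) :=
  @InnerProductSpace.Core.toSeminormedAddCommGroup ℂ P _ _ _ c

instance : InnerProductSpace ℂ (PreL2 P c) := @InnerProductSpace.ofCore ℂ P _ _ _ c

variable (P) in
/-- The Hilbert space completion of `P` for a given (semi)inner product. -/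
abbrev L2Completion : Type _ := UniformSpace.Completion (PreL2 P c)

/-- The identity map. -/
def toPreL2 : P →ₗ[ℂ] PreL2 P c where
  toFun s := s
  map_add' _ _ := rfl
  map_smul' _ _ := rfl

/-- The canonical map from `P` to its completion. -/
def toL2 : P →ₗ[ℂ] L2Completion P c :=
  (UniformSpace.Completion.toComplₗᵢ (𝕜 := ℂ) (E := PreL2 P c)).toLinearMap ∘ₗ toPreL2 c

theorem inner_toL2 (s t : P) : ⟪toL2 c s, toL2 c t⟫_ℂ = c.inner s t :=
  UniformSpace.Completion.inner_coe (toPreL2 c s) (toPreL2 c t)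

theorem denseRange_toL2 : DenseRange (toL2 c) :=
  UniformSpace.Completion.denseRange_coe (α := PreL2 P c)

end completion

section bundle

variable {n : ℕ} {X : Type*} [EMetricSpace X]
  [ChartedSpace (EuclideanSpace ℝ (Fin n)) X] [IsManifold (𝓡 n) ∞ X]
  {F : Type*} [NormedAddCommGroup F] [NormedSpace ℂ F]
  {V : X → Type*} [TopologicalSpace (TotalSpace F V)] [∀ x, NormedAddCommGroup (V x)]
  [∀ x, InnerProductSpace ℂ (V x)] [FiberBundle F V] [VectorBundle ℂ F V] [VectorBundle ℝ F V]

theorem contMDiffAt_complex_smul [ContMDiffVectorBundle ∞ F V (𝓡 n)] {s : Π x, V x} (z : ℂ) {x₀ : X}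
    (h : ContMDiffAt (𝓡 n) ((𝓡 n).prod 𝓘(ℝ, F)) ∞ (fun x => TotalSpace.mk' F x (s x)) x₀) :
    ContMDiffAt (𝓡 n) ((𝓡 n).prod 𝓘(ℝ, F)) ∞ (fun x => TotalSpace.mk' F x (z • s x)) x₀ := by
  rw [contMDiffAt_section] at h ⊢
  set e := trivializationAt F V x₀
  have h2 : ContMDiffAt (𝓡 n) 𝓘(ℝ, F) ∞ (fun x => z • (e ⟨x, s x⟩).2) x₀ :=
    ((z • ContinuousLinearMap.id ℝ F).contMDiff.contMDiffAt).comp x₀ h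
  refine h2.congr_of_eventuallyEq ?_
  filter_upwards [e.open_baseSet.mem_nhds (mem_baseSet_trivializationAt F V x₀)] with x hx
  exact (e.linear ℂ hx).2 z (s x)

instance [ContMDiffVectorBundle ∞ F V (𝓡 n)] : SMul ℂ Cₛ^∞⟮𝓡 n; F, V⟯ :=
  ⟨fun z s => ⟨fun x => z • s x, fun x => contMDiffAt_complex_smul z (s.contMDiff x)⟩⟩

instance [ContMDiffVectorBundle ∞ F V (𝓡 n)] : Module ℂ Cₛ^∞⟮𝓡 n; F, V⟯ :=
  ContMDiffSection.coe_injective.module ℂ (ContMDiffSection.coeAddHom (𝓡 n) F ∞ V) fun _ _ => rfl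

variable (n F V) in
/-- Smooth one-forms with values in `V`, the smooth sections of `T*X ⊗ V = Hom (TX, V)`. -/
abbrev OneForms : Type _ :=
  Cₛ^∞⟮𝓡 n; EuclideanSpace ℝ (Fin n) →L[ℝ] F, fun x : X => TangentSpace (𝓡 n) x →L[ℝ] V x⟯

theorem contMDiff_complex_smul_oneForm [ContMDiffVectorBundle ∞ F V (𝓡 n)]
    {α : Π x : X, TangentSpace (𝓡 n) x →L[ℝ] V x} (z : ℂ)
    (hα : ContMDiff (𝓡 n) ((𝓡 n).prod 𝓘(ℝ, EuclideanSpace ℝ (Fin n) →L[ℝ] F)) ∞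
      fun x => TotalSpace.mk' (EuclideanSpace ℝ (Fin n) →L[ℝ] F) x (α x)) :
    ContMDiff (𝓡 n) ((𝓡 n).prod 𝓘(ℝ, EuclideanSpace ℝ (Fin n) →L[ℝ] F)) ∞
      fun x => TotalSpace.mk' (EuclideanSpace ℝ (Fin n) →L[ℝ] F) x (z • α x) := by
  intro x₀
  have h := hα x₀
  rw [contMDiffAt_hom_bundle] at h ⊢
  refine ⟨h.1, ?_⟩
  have h2 := ((z • ContinuousLinearMap.id ℝ
    (EuclideanSpace ℝ (Fin n) →L[ℝ] F)).contMDiff (n := ∞).contMDiffAt).comp x₀ h.2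
  refine h2.congr_of_eventuallyEq ?_
  set e := trivializationAt F V x₀
  filter_upwards [e.open_baseSet.mem_nhds (mem_baseSet_trivializationAt F V x₀)] with x hx
  ext v
  simp only [ContinuousLinearMap.inCoordinates, Function.comp_apply, ContinuousLinearMap.comp_apply,
    smul_apply, ContinuousLinearMap.id_apply, Trivialization.continuousLinearMapAt_apply]
  rw [(trivializationAt F V x₀).coe_linearMapAt_of_mem hx]
  exact (e.linear ℂ hx).2 z _

instance [ContMDiffVectorBundle ∞ F V (𝓡 n)] : SMul ℂ (OneForms n F V) :=
  ⟨fun z α => ⟨fun x => z • α x, contMDiff_complex_smul_oneForm z α.contMDiff⟩⟩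

instance [ContMDiffVectorBundle ∞ F V (𝓡 n)] : Module ℂ (OneForms n F V) :=
  ContMDiffSection.coe_injective.module ℂ (ContMDiffSection.coeAddHom (𝓡 n) _ ∞ _) fun _ _ => rfl

variable [IsContMDiffRiemannianBundle (𝓡 n) ∞ F V] [ContMDiffVectorBundle ∞ F V (𝓡 n)]

theorem continuousAt_inner {s t : Π x, V x} {x₀ : X}
    (hs : ContMDiffAt (𝓡 n) ((𝓡 n).prod 𝓘(ℝ, F)) ∞ (fun x => TotalSpace.mk' F x (s x)) x₀)
    (ht : ContMDiffAt (𝓡 n) ((𝓡 n).prod 𝓘(ℝ, F)) ∞ (fun x => TotalSpace.mk' F x (t x)) x₀) :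
    ContinuousAt (fun x => ⟪s x, t x⟫_ℂ) x₀ := by
  have h1 : ContinuousAt (fun x => (⟪s x, t x⟫_ℂ).re) x₀ :=
    (hs.inner_bundle ht).continuousAt
  have h2 : ContinuousAt (fun x => (⟪s x, t x⟫_ℂ).im) x₀ := by
    have h := (hs.inner_bundle (contMDiffAt_complex_smul (-Complex.I) ht)).continuousAt
    refine h.congr (.of_forall fun x => ?_)
    change (⟪s x, (-Complex.I) • t x⟫_ℂ).re = _
    rw [inner_smul_right]
    simp
  refine ((Complex.continuous_ofReal.continuousAt.comp h1).add
    ((Complex.continuous_ofReal.continuousAt.comp h2).mul continuousAt_const)).congr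
      (.of_forall fun x => Complex.re_add_im _)

theorem continuous_inner_section (s t : Cₛ^∞⟮𝓡 n; F, V⟯) :
    Continuous fun x => ⟪s x, t x⟫_ℂ :=
  continuous_iff_continuousAt.2 fun x => continuousAt_inner (s.contMDiff x) (t.contMDiff x)

variable [RiemannianBundle (fun x : X => TangentSpace (𝓡 n) x)]

/-- The inner product on the fibre of `T*X ⊗ V = Hom (TX, V)`. -/
def homInner (x : X) (α β : TangentSpace (𝓡 n) x →L[ℝ] V x) : ℂ :=
  ∑ i, ⟪α (tangentONB n x i), β (tangentONB n x i)⟫_ℂ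

variable [IsContMDiffRiemannianBundle (𝓡 n) ∞ (EuclideanSpace ℝ (Fin n))
    (fun x : X => TangentSpace (𝓡 n) x)]

theorem continuous_homInner (α β : OneForms n F V) : Continuous fun x => homInner x (α x) (β x) := by
  rw [continuous_iff_continuousAt]
  intro x₀
  obtain ⟨b, g, hb, hg, h⟩ := exists_contraction (n := n) x₀
  have key : ∀ᶠ x in 𝓝 x₀, homInner x (α x) (β x) =
      ∑ j, ∑ k, g j k x • ⟪α x (b j x), β x (b k x)⟫_ℂ := by
    filter_upwards [h] with x hx
    exact hx (LinearMap.mk₂ ℝ (fun u v => ⟪α x u, β x v⟫_ℂ) (by simp [inner_add_left])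
      (by intro r u v; rw [map_smul]; exact inner_smul_left_eq_smul _ _ _) (by simp [inner_add_right])
      (by intro r u v; rw [map_smul]; exact inner_smul_right_eq_smul _ _ _))
  refine ContinuousAt.congr ?_ (Filter.EventuallyEq.symm key)
  refine tendsto_finsetSum _ fun j _ => tendsto_finsetSum _ fun k _ => ?_
  exact (hg j k).continuousAt.smul (continuousAt_inner
    ((α.contMDiff x₀).clm_bundle_apply (hb j)) ((β.contMDiff x₀).clm_bundle_apply (hb k)))

end bundle

section l2
variable {n : ℕ} {X : Type*} [EMetricSpace X] [CompactSpace X] [MeasurableSpace X] [BorelSpace X]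
  [ChartedSpace (EuclideanSpace ℝ (Fin n)) X] [IsManifold (𝓡 n) ∞ X]
  [RiemannianBundle (fun x : X => TangentSpace (𝓡 n) x)]
  [IsContMDiffRiemannianBundle (𝓡 n) ∞ (EuclideanSpace ℝ (Fin n))
    (fun x : X => TangentSpace (𝓡 n) x)]
  [IsRiemannianManifold (𝓡 n) X]
  {F : Type*} [NormedAddCommGroup F] [NormedSpace ℂ F]
  {V : X → Type*} [TopologicalSpace (TotalSpace F V)] [∀ x, NormedAddCommGroup (V x)]
  [∀ x, InnerProductSpace ℂ (V x)] [FiberBundle F V] [VectorBundle ℂ F V] [VectorBundle ℝ F V]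
  [ContMDiffVectorBundle ∞ F V (𝓡 n)] [IsContMDiffRiemannianBundle (𝓡 n) ∞ F V]

theorem integrable_volume {u : X → ℂ} (hu : Continuous u) : Integrable u (μHE[n] : Measure X) := by
  have := isFiniteMeasure_riemannianVolume (n := n) (X := X)
  exact hu.integrable_of_hasCompactSupport (HasCompactSupport.of_compactSpace u)

variable (n F V) in
/-- The `L²` inner product of smooth sections of `V`, for the Riemannian volume. -/
@[reducible]
def sectionCore : PreInnerProductSpace.Core ℂ Cₛ^∞⟮𝓡 n; F, V⟯ where
  inner s t := ∫ x, ⟪s x, t x⟫_ℂ ∂(μHE[n] : Measure X)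
  conj_inner_symm s t := by
    rw [← integral_conj]
    exact integral_congr_ae (.of_forall fun x => inner_conj_symm (s x) (t x))
  re_inner_nonneg s := by
    have h : ∫ x, ⟪s x, s x⟫_ℂ ∂(μHE[n] : Measure X) = ((∫ x, ‖s x‖ ^ 2 ∂(μHE[n] : Measure X) : ℝ) : ℂ) := by
      rw [← integral_complex_ofReal]
      refine integral_congr_ae (.of_forall fun x => ?_)
      simp [inner_self_eq_norm_sq_to_K]
    rw [h]
    exact integral_nonneg fun x => sq_nonneg _
  add_left s t u := by
    rw [← integral_add (integrable_volume (continuous_inner_section s u))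
      (integrable_volume (continuous_inner_section t u))]
    exact integral_congr_ae (.of_forall fun x => inner_add_left (s x) (t x) (u x))
  smul_left s t z := by
    rw [← integral_const_mul]
    exact integral_congr_ae (.of_forall fun x => inner_smul_left (s x) (t x) z)

variable (n F V) in
/-- The `L²` inner product of smooth one-forms with values in `V`. -/
@[reducible]
def oneFormCore : PreInnerProductSpace.Core ℂ (OneForms n F V) where
  inner α β := ∫ x, homInner x (α x) (β x) ∂(μHE[n] : Measure X)
  conj_inner_symm s t := by
    rw [← integral_conj]
    refine integral_congr_ae (.of_forall fun x => ?_)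
    simp [homInner]
  re_inner_nonneg s := by
    have h : ∫ x, homInner x (s x) (s x) ∂(μHE[n] : Measure X) =
        ((∫ x, ∑ i, ‖s x (tangentONB n x i)‖ ^ 2 ∂(μHE[n] : Measure X) : ℝ) : ℂ) := by
      rw [← integral_complex_ofReal]
      refine integral_congr_ae (.of_forall fun x => ?_)
      simp [homInner, inner_self_eq_norm_sq_to_K]
    rw [h]
    exact integral_nonneg fun x => Finset.sum_nonneg fun i _ => sq_nonneg _
  add_left s t u := by
    rw [← integral_add (integrable_volume (continuous_homInner s u))
      (integrable_volume (continuous_homInner t u))]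
    refine integral_congr_ae (.of_forall fun x => ?_)
    simp only [homInner, ← Finset.sum_add_distrib]
    exact Finset.sum_congr rfl fun i _ => inner_add_left _ _ _
  smul_left s t z := by
    rw [← integral_const_mul]
    refine integral_congr_ae (.of_forall fun x => ?_)
    simp only [homInner, Finset.mul_sum]
    exact Finset.sum_congr rfl fun i _ => inner_smul_left _ _ _

variable (n F V) in
/-- The Hilbert space `L²(V)`. -/
abbrev L2Sections : Type _ := L2Completion Cₛ^∞⟮𝓡 n; F, V⟯ (sectionCore n F V)

variable (n F V) in
/-- The Hilbert space `L²(T*X ⊗ V)`. -/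
abbrev L2OneForms : Type _ := L2Completion (OneForms n F V) (oneFormCore n F V)

/-- The closure, as an unbounded operator between the completions, of an operator `A` defined on
the dense subspace `P`: the operator whose graph is the closure of the graph of `A`. -/
def closedOperator {P Q : Type*} [AddCommGroup P] [Module ℂ P] [AddCommGroup Q] [Module ℂ Q]
    (c : PreInnerProductSpace.Core ℂ P) (d : PreInnerProductSpace.Core ℂ Q) (A : P →ₗ[ℂ] Q) :
    L2Completion P c →ₗ.[ℂ] L2Completion Q d :=
  (((toL2 c).prod (toL2 d ∘ₗ A)).range.topologicalClosure).toLinearPMap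

end l2

section connection
variable {n : ℕ} {X : Type*} [EMetricSpace X] 
  [ChartedSpace (EuclideanSpace ℝ (Fin n)) X] [IsManifold (𝓡 n) ∞ X]
  {F : Type*} [NormedAddCommGroup F] [NormedSpace ℂ F] [FiniteDimensional ℂ F]
  {V : X → Type*} [TopologicalSpace (TotalSpace F V)] [∀ x, NormedAddCommGroup (V x)]
  [∀ x, InnerProductSpace ℂ (V x)] [FiberBundle F V] [VectorBundle ℂ F V] [VectorBundle ℝ F V]
  [ContMDiffVectorBundle ∞ F V (𝓡 n)] [IsContMDiffRiemannianBundle (𝓡 n) ∞ F V]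

instance instRiemannianBundleOne : IsContMDiffRiemannianBundle (𝓡 n) 1 F V :=
  IsContMDiffRiemannianBundle.of_le (n := ∞) (by simp)
instance : ContMDiffVectorBundle 1 F V (𝓡 n) := ContMDiffVectorBundle.of_le (n := ∞) (by simp)

/-- A smooth, complex linear connection which is compatible with the hermitian metric. -/
structure IsMetricConnection (cov : CovariantDerivative (𝓡 n) F V) : Prop where
  smooth : ContMDiffCovariantDerivative cov ∞
  complexLinear : ∀ (z : ℂ) (s : Cₛ^∞⟮𝓡 n; F, V⟯) (x : X), cov (fun y => z • s y) x = z • cov s x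
  metric : cov.IsMetricCompatible

/-- The connection as an operator from smooth sections to smooth one-forms with values in `V`. -/
def nabla {cov : CovariantDerivative (𝓡 n) F V} (h : IsMetricConnection cov) :
    Cₛ^∞⟮𝓡 n; F, V⟯ →ₗ[ℂ] OneForms n F V where
  toFun s := ⟨fun x => cov s x, by
    have := h.smooth.contMDiff.contMDiff (σ := s) (by simpa using s.contMDiff.contMDiffOn)
    simpa using contMDiffOn_univ.1 this⟩
  map_add' s t := by
    ext1 x
    exact cov.isCovariantDerivativeOnUniv.add (s.contMDiff.mdifferentiable (by simp) x)
      (t.contMDiff.mdifferentiable (by simp) x) trivial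
  map_smul' z s := by
    ext1 x
    exact h.complexLinear z s x

variable [RiemannianBundle (fun x : X => TangentSpace (𝓡 n) x)]
  [IsContMDiffRiemannianBundle (𝓡 n) ∞ (EuclideanSpace ℝ (Fin n))
    (fun x : X => TangentSpace (𝓡 n) x)]

/-- `c` is a Clifford multiplication which makes `V`, with the metric connection `cov`, a Dirac bundle:
`c` is a smooth, complex linear action with `c(v)² = -‖v‖²` and with skew-hermitian `c(v)`, and the
connection is a derivation over the Levi-Civita connection `lc`. Spinor bundles and twisted spinor
bundles are of this kind. -/
structure IsDiracBundle (cov : CovariantDerivative (𝓡 n) F V)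
    (lc : CovariantDerivative (𝓡 n) (EuclideanSpace ℝ (Fin n)) (fun x : X => TangentSpace (𝓡 n) x))
    (c : Π x : X, TangentSpace (𝓡 n) x →L[ℝ] V x →L[ℝ] V x) : Prop where
  lc_metric : lc.IsMetricCompatible
  lc_torsion : lc.torsion = 0
  smooth : ContMDiff (𝓡 n) ((𝓡 n).prod 𝓘(ℝ, EuclideanSpace ℝ (Fin n) →L[ℝ] F →L[ℝ] F)) ∞
    fun x => TotalSpace.mk' (EuclideanSpace ℝ (Fin n) →L[ℝ] F →L[ℝ] F) x (c x)
  complexLinear : ∀ (x : X) (v : TangentSpace (𝓡 n) x) (z : ℂ) (w : V x), c x v (z • w) = z • c x v w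
  clifford : ∀ (x : X) (v : TangentSpace (𝓡 n) x) (w : V x), c x v (c x v w) = -((‖v‖ ^ 2 : ℝ) • w)
  skew : ∀ (x : X) (v : TangentSpace (𝓡 n) x) (w w' : V x), ⟪c x v w, w'⟫_ℂ = -⟪w, c x v w'⟫_ℂ
  leibniz : ∀ (Y : Cₛ^∞⟮𝓡 n; EuclideanSpace ℝ (Fin n), fun x : X => TangentSpace (𝓡 n) x⟯)
    (s : Cₛ^∞⟮𝓡 n; F, V⟯) (x : X) (u : TangentSpace (𝓡 n) x),
    cov (fun y => c y (Y y) (s y)) x u = c x (lc Y x u) (s x) + c x (Y x) (cov s x u)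

/-- The Dirac operator `D s = ∑ e_i · ∇_{e_i} s` on smooth sections. -/
def dirac {cov : CovariantDerivative (𝓡 n) F V} (h : IsMetricConnection cov)
    {lc : CovariantDerivative (𝓡 n) (EuclideanSpace ℝ (Fin n)) (fun x : X => TangentSpace (𝓡 n) x)}
    {c : Π x : X, TangentSpace (𝓡 n) x →L[ℝ] V x →L[ℝ] V x} (hc : IsDiracBundle cov lc c) :
    Cₛ^∞⟮𝓡 n; F, V⟯ →ₗ[ℂ] Cₛ^∞⟮𝓡 n; F, V⟯ where
  toFun s := ⟨fun x => ∑ i, c x (tangentONB n x i) (cov s x (tangentONB n x i)), by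
    intro x₀
    obtain ⟨b, g, hb, hg, hB⟩ := exists_contraction (n := n) x₀
    have key : ∀ᶠ x in 𝓝 x₀, ∑ i, c x (tangentONB n x i) (cov s x (tangentONB n x i)) =
        ∑ j, ∑ k, g j k x • c x (b j x) (cov s x (b k x)) := by
      filter_upwards [hB] with x hx
      exact hx (LinearMap.mk₂ ℝ (fun u v => c x u (cov s x v)) (by simp) (by simp)
        (by simp) (by simp))
    have hs := (nabla h s).contMDiff
    have h3 : ContMDiffAt (𝓡 n) ((𝓡 n).prod 𝓘(ℝ, F)) ∞ (fun x => TotalSpace.mk' F x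
        (∑ j, ∑ k, g j k x • c x (b j x) (cov s x (b k x)))) x₀ := by
      refine ContMDiffAt.sum_section fun j _ => ContMDiffAt.sum_section fun k _ => ?_
      refine (hg j k).smul_section ?_
      exact (hc.smooth x₀).clm_bundle_apply₂ (hb j) ((hs x₀).clm_bundle_apply (hb k))
    refine h3.congr_of_eventuallyEq ?_
    filter_upwards [key] with x hx
    rw [hx]⟩
  map_add' s t := by
    ext1 x
    have := congrArg (fun α : OneForms n F V => α x) ((nabla h).map_add s t)
    change cov (s + t : Cₛ^∞⟮𝓡 n; F, V⟯) x = cov s x + cov t x at this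
    change ∑ i, c x (tangentONB n x i) (cov (s + t : Cₛ^∞⟮𝓡 n; F, V⟯) x (tangentONB n x i)) =
      ∑ i, c x (tangentONB n x i) (cov s x (tangentONB n x i)) +
      ∑ i, c x (tangentONB n x i) (cov t x (tangentONB n x i))
    rw [this, ← Finset.sum_add_distrib]
    simp
  map_smul' z s := by
    ext1 x
    have := congrArg (fun α : OneForms n F V => α x) ((nabla h).map_smul z s)
    change cov (z • s : Cₛ^∞⟮𝓡 n; F, V⟯) x = z • cov s x at this
    change ∑ i, c x (tangentONB n x i) (cov (z • s : Cₛ^∞⟮𝓡 n; F, V⟯) x (tangentONB n x i)) =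
      z • ∑ i, c x (tangentONB n x i) (cov s x (tangentONB n x i))
    rw [this, Finset.smul_sum]
    exact Finset.sum_congr rfl fun i _ => hc.complexLinear _ _ _ _

end connection

section forms

variable {n : ℕ} {X : Type*} [EMetricSpace X] [CompactSpace X] [MeasurableSpace X] [BorelSpace X]
  [ChartedSpace (EuclideanSpace ℝ (Fin n)) X] [IsManifold (𝓡 n) ∞ X]
  [RiemannianBundle (fun x : X => TangentSpace (𝓡 n) x)]
  [IsContMDiffRiemannianBundle (𝓡 n) ∞ (EuclideanSpace ℝ (Fin n))
    (fun x : X => TangentSpace (𝓡 n) x)]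
  [IsRiemannianManifold (𝓡 n) X]
  {F : Type*} [NormedAddCommGroup F] [NormedSpace ℂ F] [FiniteDimensional ℂ F]
  {V : X → Type*} [TopologicalSpace (TotalSpace F V)] [∀ x, NormedAddCommGroup (V x)]
  [∀ x, InnerProductSpace ℂ (V x)] [FiberBundle F V] [VectorBundle ℂ F V] [VectorBundle ℝ F V]
  [ContMDiffVectorBundle ∞ F V (𝓡 n)] [IsContMDiffRiemannianBundle (𝓡 n) ∞ F V]
  {cov : CovariantDerivative (𝓡 n) F V}

/-- The quadratic form of the connection laplacian `∇* ∇` on the operators on `L²(V)`. -/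
def laplacianForm (h : IsMetricConnection cov) :
    (L2Sections n F V →L[ℂ] L2Sections n F V) → ℝ≥0∞ :=
  hsForm (closedOperator (sectionCore n F V) (oneFormCore n F V) (nabla h))

/-- The quadratic form of the Dirac laplacian `D² = D* D` on the operators on `L²(V)`. -/
def diracLaplacianForm (h : IsMetricConnection cov)
    {lc : CovariantDerivative (𝓡 n) (EuclideanSpace ℝ (Fin n)) (fun x : X => TangentSpace (𝓡 n) x)}
    {c : Π x : X, TangentSpace (𝓡 n) x →L[ℝ] V x →L[ℝ] V x} (hc : IsDiracBundle cov lc c) :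
    (L2Sections n F V →L[ℂ] L2Sections n F V) → ℝ≥0∞ :=
  hsForm (closedOperator (sectionCore n F V) (sectionCore n F V) (dirac h hc))

end forms

end

attribute [local instance 50] InnerProductSpace.complexToReal

/-! ### The Hilbert–Schmidt norm with values in `[0, ∞]`. -/

section hilbertSchmidtNorm

variable {H K : Type*} [NormedAddCommGroup H] [InnerProductSpace ℂ H]
  [NormedAddCommGroup K] [InnerProductSpace ℂ K]

/-! Both geometric statements are instances of the abstract one: the only fact needed about `∇` and
`D` is that their closures are densely defined. So let `S` be densely defined with closed form `E(x)
= ‖Sx‖²_HS`.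

The contraction property is a computation in an eigenbasis. A self-adjoint Hilbert–Schmidt `x` is
compact, so it has an orthonormal eigenbasis `b i` with real eigenvalues `μ i`. If `E(x) < ∞`, then
`A = Sx` is bounded and `E(x) = ∑ ‖A b_i‖²`. Now `f(x) b_i = f(μ_i) b_i`, and `S` sends this vector
to `(f(μ_i)/μ_i) A b_i`, whose norm is at most `C ‖A b_i‖` because `f` is `C`-Lipschitz and vanishes
at `0`. Hence the finite truncations of `f(x)` lie in the domain, converge to `f(x)` in
Hilbert–Schmidt norm and are `E`-Cauchy. Closedness of `E` puts `f(x)` in the domain, and summing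
over `i` gives the inequality (`hsForm_cfc_le`).

For density, `x` is approximated by `PxP`, where `P` projects onto a finite-dimensional subspace of
`Dom(S)`, on which `S` is bounded (`dense_formDomain_hsForm`).

For complete Dirichletness, `E ⊗ 1_m` agrees on self-adjoint operators with the form of the direct
sum of `m` copies of `S`: the entries satisfy `x_ji = x_ij*`, and the parallelogram law converts
`E(y) + E(y*)` into `2 (E(Re y) + E(Im y))` (`hsForm_amplOperator_eq_amplForm`). Closedness passes
to `E ⊗ 1_m` entry by entry (`IsClosedForm.amplForm`), so the first part applies to the direct sum.
-/

theorem enorm_sq_eq_ofReal {G : Type*} [SeminormedAddCommGroup G] (v : G) :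
    ‖v‖ₑ ^ 2 = ENNReal.ofReal (‖v‖ ^ 2) := by
  rw [ENNReal.ofReal_pow (norm_nonneg _), ofReal_norm]

theorem parallelogram_enorm (v w : H) :
    ‖v + w‖ₑ ^ 2 + ‖v - w‖ₑ ^ 2 = 2 * ‖v‖ₑ ^ 2 + 2 * ‖w‖ₑ ^ 2 := by
  have h := parallelogram_law_with_norm ℂ v w
  have h2 : (2 : ℝ≥0∞) = ENNReal.ofReal 2 := by simp
  simp only [enorm_sq_eq_ofReal, h2]
  rw [← ENNReal.ofReal_add (by positivity) (by positivity),
    ← ENNReal.ofReal_mul (by positivity), ← ENNReal.ofReal_mul (by positivity),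
    ← ENNReal.ofReal_add (by positivity) (by positivity)]
  congr 1
  linarith

theorem HilbertBasis.tsum_enorm_inner_sq {ι : Type*} (b : HilbertBasis ι ℂ H) (v : H) :
    ∑' i, ‖⟪b i, v⟫_ℂ‖ₑ ^ 2 = ‖v‖ₑ ^ 2 := by
  have h : HasSum (fun i => ‖⟪b i, v⟫_ℂ‖ ^ 2) (‖v‖ ^ 2) := by
    have h1 := (Complex.hasSum_re (b.hasSum_inner_mul_inner v v))
    convert h1 using 1
    · ext i
      rw [← inner_conj_symm v (b i), Complex.conj_mul']
      norm_cast
    · rw [inner_self_eq_norm_sq_to_K]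
      norm_cast
  simp only [enorm_sq_eq_ofReal]
  rw [← ENNReal.ofReal_tsum_of_nonneg (fun i => by positivity) h.summable, h.tsum_eq]

theorem Orthonormal.sum_enorm_inner_sq_le {s : Finset H}
    (hs : Orthonormal ℂ ((↑) : s → H)) (v : H) :
    ∑ w ∈ s, ‖⟪w, v⟫_ℂ‖ₑ ^ 2 ≤ ‖v‖ₑ ^ 2 := by
  simp only [enorm_sq_eq_ofReal]
  rw [← ENNReal.ofReal_sum_of_nonneg fun i _ => by positivity]
  refine ENNReal.ofReal_le_ofReal ?_
  have := hs.sum_inner_products_le v (s := Finset.univ)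
  rwa [Finset.sum_coe_sort s fun w => ‖⟪w, v⟫_ℂ‖ ^ 2] at this

section bounded

variable [CompleteSpace H] [CompleteSpace K]

theorem tsum_enorm_sq_adjoint {ι κ : Type*} (b : HilbertBasis ι ℂ H) (d : HilbertBasis κ ℂ K)
    (A : H →L[ℂ] K) : ∑' i, ‖A (b i)‖ₑ ^ 2 = ∑' k, ‖A.adjoint (d k)‖ₑ ^ 2 := by
  simp only [← d.tsum_enorm_inner_sq (A _), ← b.tsum_enorm_inner_sq (A.adjoint _)]
  rw [ENNReal.tsum_comm]
  refine tsum_congr fun k => tsum_congr fun i => ?_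
  rw [ContinuousLinearMap.adjoint_inner_right, ← inner_conj_symm]
  simp only [enorm_sq_eq_ofReal, RCLike.norm_conj]

/-- Parseval in `K` followed by an exchange of sums reduces this to Bessel's inequality for the
finite family, applied to each `A* d_k`. It is the upper bound in `hsNormSq_eq_tsum`. -/
theorem hsNormSq_le_of_tsum_adjoint {κ : Type*} (d : HilbertBasis κ ℂ K) (A : H →L[ℂ] K) :
    hsNormSq (A : H →ₗ[ℂ] K) ≤ ∑' k, ‖A.adjoint (d k)‖ₑ ^ 2 := by
  refine iSup₂_le fun s hs => ?_
  simp only [ContinuousLinearMap.coe_coe, ← d.tsum_enorm_inner_sq (A _)]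
  rw [← Summable.tsum_finsetSum fun _ _ => ENNReal.summable]
  refine ENNReal.tsum_le_tsum fun k => ?_
  refine le_trans (le_of_eq (Finset.sum_congr rfl fun v _ => ?_))
    (hs.sum_enorm_inner_sq_le (A.adjoint (d k)))
  rw [ContinuousLinearMap.adjoint_inner_right, ← inner_conj_symm]
  simp only [enorm_sq_eq_ofReal, RCLike.norm_conj]

theorem hsNormSq_eq_tsum {ι : Type*} (b : HilbertBasis ι ℂ H) (A : H →L[ℂ] K) :
    hsNormSq (A : H →ₗ[ℂ] K) = ∑' i, ‖A (b i)‖ₑ ^ 2 := by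
  classical
  obtain ⟨_, d, -⟩ := exists_hilbertBasis ℂ K
  refine le_antisymm ?_ ?_
  · rw [tsum_enorm_sq_adjoint b d]
    exact hsNormSq_le_of_tsum_adjoint d A
  · rw [ENNReal.tsum_eq_iSup_sum]
    refine iSup_le fun s => ?_
    have hinj : Function.Injective b := b.orthonormal.linearIndependent.injective
    refine le_trans (le_of_eq ?_) (le_iSup₂ (f := fun (s : Finset H)
      (_ : Orthonormal ℂ ((↑) : s → H)) => ∑ v ∈ s, ‖(A : H →ₗ[ℂ] K) v‖ₑ ^ 2) (s.image b) ?_)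
    · rw [Finset.sum_image fun _ _ _ _ h => hinj h]
      rfl
    · refine (b.orthonormal.toSubtypeRange).comp
        (fun v : (s.image b : Finset H) => (⟨v, ?_⟩ : Set.range b)) ?_
      · obtain ⟨i, -, hi⟩ := Finset.mem_image.1 v.2
        exact ⟨i, hi⟩
      · intro v w h
        exact Subtype.ext (congrArg (fun u : Set.range b => (u : H)) h)

theorem hsNormSq_adjoint (A : H →L[ℂ] K) :
    hsNormSq (A.adjoint : K →ₗ[ℂ] H) = hsNormSq (A : H →ₗ[ℂ] K) := by
  obtain ⟨_, b, -⟩ := exists_hilbertBasis ℂ H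
  obtain ⟨_, d, -⟩ := exists_hilbertBasis ℂ K
  rw [hsNormSq_eq_tsum b, hsNormSq_eq_tsum d, tsum_enorm_sq_adjoint b d]

theorem hsNormSq_mono {G : Type*} [NormedAddCommGroup G] [InnerProductSpace ℂ G] [CompleteSpace G]
    {A : H →L[ℂ] K} {B : H →L[ℂ] G} {C : ℝ≥0∞} (h : ∀ v, ‖A v‖ₑ ^ 2 ≤ C * ‖B v‖ₑ ^ 2) :
    hsNormSq (A : H →ₗ[ℂ] K) ≤ C * hsNormSq (B : H →ₗ[ℂ] G) := by
  obtain ⟨_, b, -⟩ := exists_hilbertBasis ℂ H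
  rw [hsNormSq_eq_tsum b, hsNormSq_eq_tsum b, ← ENNReal.tsum_mul_left]
  exact ENNReal.tsum_le_tsum fun i => h _

theorem hsNormSq_parallelogram_of_bounded (A B : H →L[ℂ] K) :
    hsNormSq ((A + B : H →L[ℂ] K) : H →ₗ[ℂ] K) + hsNormSq ((A - B : H →L[ℂ] K) : H →ₗ[ℂ] K) =
      2 * hsNormSq (A : H →ₗ[ℂ] K) + 2 * hsNormSq (B : H →ₗ[ℂ] K) := by
  obtain ⟨_, b, -⟩ := exists_hilbertBasis ℂ H
  simp only [hsNormSq_eq_tsum b, ← ENNReal.tsum_mul_left, ← ENNReal.tsum_add]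
  exact tsum_congr fun i => parallelogram_enorm _ _

theorem hsNormSq_add_le (A B : H →L[ℂ] K) :
    hsNormSq ((A + B : H →L[ℂ] K) : H →ₗ[ℂ] K) ≤
      2 * hsNormSq (A : H →ₗ[ℂ] K) + 2 * hsNormSq (B : H →ₗ[ℂ] K) :=
  le_self_add.trans (hsNormSq_parallelogram_of_bounded A B).le

end bounded

theorem enorm_sq_apply_le_hsNormSq (A : H →ₗ[ℂ] K) (v : H) :
    ‖A v‖ₑ ^ 2 ≤ hsNormSq A * ‖v‖ₑ ^ 2 := by
  rcases eq_or_ne v 0 with rfl | hv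
  · simp
  have hv' : ‖v‖ ≠ 0 := norm_ne_zero_iff.2 hv
  set w : H := ((‖v‖⁻¹ : ℝ) : ℂ) • v with hw
  have hw1 : ‖w‖ = 1 := by
    rw [hw, norm_smul, Complex.norm_real, norm_inv, norm_norm, inv_mul_cancel₀ hv']
  have hvw : v = ((‖v‖ : ℝ) : ℂ) • w := by
    rw [hw, smul_smul, ← Complex.ofReal_mul, mul_inv_cancel₀ hv', Complex.ofReal_one, one_smul]
  have h1 : ‖A w‖ₑ ^ 2 ≤ hsNormSq A := by
    refine le_trans (le_of_eq ?_) (le_iSup₂ (f := fun (s : Finset H)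
      (_ : Orthonormal ℂ ((↑) : s → H)) => ∑ v ∈ s, ‖A v‖ₑ ^ 2) {w} ?_)
    · simp
    · refine ⟨fun u => ?_, fun u u' huu => ?_⟩
      · rw [Finset.mem_singleton.1 u.2, hw1]
      · exact absurd (Subtype.ext ((Finset.mem_singleton.1 u.2).trans
          (Finset.mem_singleton.1 u'.2).symm)) huu
  have h2 : ‖A v‖ₑ ^ 2 = ‖v‖ₑ ^ 2 * ‖A w‖ₑ ^ 2 := by
    conv_lhs => rw [hvw, map_smul, enorm_smul, mul_pow]
    congr 2
    rw [← ofReal_norm, ← ofReal_norm, Complex.norm_real, norm_norm]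
  rw [h2, mul_comm]
  gcongr

/-- One-element orthonormal families already bound `‖A v‖` on unit vectors. This makes `Sx` bounded
whenever the form is finite at `x`, with no appeal to a closed graph. -/
theorem exists_clm_of_hsNormSq_lt_top {A : H →ₗ[ℂ] K} (h : hsNormSq A < ⊤) :
    ∃ B : H →L[ℂ] K, (B : H →ₗ[ℂ] K) = A := by
  refine ⟨A.mkContinuous (Real.sqrt (hsNormSq A).toReal) fun v => ?_, by ext; rfl⟩
  have h1 := enorm_sq_apply_le_hsNormSq A v
  rw [enorm_sq_eq_ofReal, enorm_sq_eq_ofReal, ← ENNReal.ofReal_toReal h.ne,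
    ← ENNReal.ofReal_mul ENNReal.toReal_nonneg, ENNReal.ofReal_le_ofReal_iff (by positivity)] at h1
  refine abs_le_of_sq_le_sq' ?_ (by positivity) |>.2
  rwa [mul_pow, Real.sq_sqrt ENNReal.toReal_nonneg]

variable [CompleteSpace H] [CompleteSpace K]

theorem hsNormSq_smul (A : H →ₗ[ℂ] K) (z : ℂ) :
    hsNormSq (z • A) = ‖z‖ₑ ^ 2 * hsNormSq A := by
  simp only [hsNormSq, LinearMap.smul_apply, enorm_smul, mul_pow, ← Finset.mul_sum,
    ENNReal.mul_iSup]

theorem hsNormSq_add_lt_top {A B : H →ₗ[ℂ] K} (hA : hsNormSq A < ⊤) (hB : hsNormSq B < ⊤) :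
    hsNormSq (A + B) < ⊤ ∧ hsNormSq (A - B) < ⊤ := by
  obtain ⟨A, rfl⟩ := exists_clm_of_hsNormSq_lt_top hA
  obtain ⟨B, rfl⟩ := exists_clm_of_hsNormSq_lt_top hB
  have h := hsNormSq_parallelogram_of_bounded A B
  have : 2 * hsNormSq (A : H →ₗ[ℂ] K) + 2 * hsNormSq (B : H →ₗ[ℂ] K) < ⊤ :=
    ENNReal.add_lt_top.2 ⟨ENNReal.mul_lt_top (by simp) hA, ENNReal.mul_lt_top (by simp) hB⟩
  rw [← h] at this
  exact ENNReal.add_lt_top.1 this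

theorem hsNormSq_parallelogram (A B : H →ₗ[ℂ] K) :
    hsNormSq (A + B) + hsNormSq (A - B) = 2 * hsNormSq A + 2 * hsNormSq B := by
  by_cases hAB : hsNormSq A < ⊤ ∧ hsNormSq B < ⊤
  · obtain ⟨hA, hB⟩ := hAB
    obtain ⟨A, rfl⟩ := exists_clm_of_hsNormSq_lt_top hA
    obtain ⟨B, rfl⟩ := exists_clm_of_hsNormSq_lt_top hB
    exact hsNormSq_parallelogram_of_bounded A B
  · have hr : 2 * hsNormSq A + 2 * hsNormSq B = ⊤ := by
      by_contra hne
      refine hAB ?_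
      have := ENNReal.add_lt_top.1 (lt_top_iff_ne_top.2 hne)
      exact ⟨(ENNReal.mul_lt_top_iff.1 this.1).elim And.right (by rintro (h | h) <;> simp_all),
        (ENNReal.mul_lt_top_iff.1 this.2).elim And.right (by rintro (h | h) <;> simp_all)⟩
    rw [hr]
    by_contra hne
    refine hAB ?_
    have h1 := ENNReal.add_lt_top.1 (lt_top_iff_ne_top.2 hne)
    have h2 := hsNormSq_add_lt_top h1.1 h1.2
    -- If the left side were finite, `2A` and `2B` would be a sum and a difference of
    -- Hilbert–Schmidt operators.
    have e1 : A + B + (A - B) = (2 : ℂ) • A := by rw [two_smul]; abel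
    have e2 : A + B - (A - B) = (2 : ℂ) • B := by rw [two_smul]; abel
    rw [e1, e2, hsNormSq_smul, hsNormSq_smul] at h2
    exact ⟨(ENNReal.mul_lt_top_iff.1 h2.1).elim And.right (by rintro (h | h) <;> simp_all),
      (ENNReal.mul_lt_top_iff.1 h2.2).elim And.right (by rintro (h | h) <;> simp_all)⟩

end hilbertSchmidtNorm

/-! ### The form of `S* S` on operators. -/

section forms

variable {H K : Type*} [NormedAddCommGroup H] [InnerProductSpace ℂ H] [CompleteSpace H]
  [NormedAddCommGroup K] [InnerProductSpace ℂ K] [CompleteSpace K]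

/-- Working with the graph of `S` instead of its domain subtype: any linear lift `A` of `x` to the
graph computes the form, so sums, multiples and finite-rank operators are handled by exhibiting
their lifts. -/
theorem hsForm_eq_hsNormSq {S : H →ₗ.[ℂ] K} {x : H →L[ℂ] H} {A : H →ₗ[ℂ] K}
    (h : ∀ v, (x v, A v) ∈ S.graph) : hsForm S x = hsNormSq A := by
  have hd : ∀ v, x v ∈ S.domain := fun v => LinearPMap.mem_domain_of_mem_graph (h v)
  rw [hsForm, dif_pos hd]
  congr 1
  ext v
  exact ((LinearPMap.image_iff (hd v)).2 (h v)).symm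

theorem exists_lift_of_forall_mem {S : H →ₗ.[ℂ] K} {x : H →L[ℂ] H} (h : ∀ v, x v ∈ S.domain) :
    ∃ A : H →ₗ[ℂ] K, ∀ v, (x v, A v) ∈ S.graph :=
  ⟨S.toFun ∘ₗ (x : H →ₗ[ℂ] H).codRestrict S.domain h, fun v => S.mem_graph ⟨x v, h v⟩⟩

theorem forall_mem_of_hsForm_lt_top {S : H →ₗ.[ℂ] K} {x : H →L[ℂ] H} (h : hsForm S x < ⊤) :
    ∀ v, x v ∈ S.domain := by
  by_contra hd
  rw [hsForm, dif_neg hd] at h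
  exact lt_irrefl _ h

theorem exists_lift_of_hsForm_lt_top {S : H →ₗ.[ℂ] K} {x : H →L[ℂ] H} (h : hsForm S x < ⊤) :
    ∃ A : H →L[ℂ] K, ∀ v, (x v, A v) ∈ S.graph := by
  obtain ⟨A, hA⟩ := exists_lift_of_forall_mem (forall_mem_of_hsForm_lt_top h)
  rw [hsForm_eq_hsNormSq hA] at h
  obtain ⟨B, rfl⟩ := exists_clm_of_hsNormSq_lt_top h
  exact ⟨B, hA⟩

theorem hsForm_eq_top {S : H →ₗ.[ℂ] K} {x : H →L[ℂ] H} (h : ¬ ∀ v, x v ∈ S.domain) :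
    hsForm S x = ⊤ := dif_neg h

theorem hsNormSq_zero : hsNormSq (0 : H →ₗ[ℂ] K) = 0 := by
  have := hsNormSq_smul (0 : H →ₗ[ℂ] K) 0
  simpa using this

theorem hsForm_smul (S : H →ₗ.[ℂ] K) (z : ℂ) (x : H →L[ℂ] H) :
    hsForm S (z • x) = ‖z‖ₑ ^ 2 * hsForm S x := by
  rcases eq_or_ne z 0 with rfl | hz
  -- The zero operator has form `0` even when `x` leaves the domain; the right side is then `0 * ⊤ =
  -- 0`.
  · rw [hsForm_eq_hsNormSq (A := (0 : H →ₗ[ℂ] K)) (by simp), hsNormSq_zero]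
    simp
  by_cases h : ∀ v, x v ∈ S.domain
  · obtain ⟨A, hA⟩ := exists_lift_of_forall_mem h
    rw [hsForm_eq_hsNormSq hA, hsForm_eq_hsNormSq (A := z • A)
      (fun v => S.graph.smul_mem z (hA v)), hsNormSq_smul]
  · rw [hsForm_eq_top h, hsForm_eq_top, ENNReal.mul_top]
    · simpa using hz
    · intro h'
      refine h fun v => ?_
      have := S.domain.smul_mem z⁻¹ (h' v)
      rwa [smul_apply, smul_smul, inv_mul_cancel₀ hz, one_smul] at this

theorem hsForm_parallelogram (S : H →ₗ.[ℂ] K) (x y : H →L[ℂ] H) :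
    hsForm S (x + y) + hsForm S (x - y) = 2 * hsForm S x + 2 * hsForm S y := by
  by_cases h : (∀ v, x v ∈ S.domain) ∧ ∀ v, y v ∈ S.domain
  · obtain ⟨A, hA⟩ := exists_lift_of_forall_mem h.1
    obtain ⟨B, hB⟩ := exists_lift_of_forall_mem h.2
    rw [hsForm_eq_hsNormSq hA, hsForm_eq_hsNormSq hB,
      hsForm_eq_hsNormSq (A := A + B) (fun v => S.graph.add_mem (hA v) (hB v)),
      hsForm_eq_hsNormSq (A := A - B) (fun v => S.graph.sub_mem (hA v) (hB v)),
      hsNormSq_parallelogram]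
  · have h1 : 2 * hsForm S x + 2 * hsForm S y = ⊤ := by
      rcases not_and_or.1 h with h | h <;> rw [hsForm_eq_top h] <;> simp
    have h2 : hsForm S (x + y) = ⊤ ∨ hsForm S (x - y) = ⊤ := by
      by_contra! hne
      have ha := forall_mem_of_hsForm_lt_top (lt_top_iff_ne_top.2 hne.1)
      have hb := forall_mem_of_hsForm_lt_top (lt_top_iff_ne_top.2 hne.2)
      refine h ⟨fun v => ?_, fun v => ?_⟩
      · have := S.domain.smul_mem (2 : ℂ)⁻¹ (S.domain.add_mem (ha v) (hb v))
        rwa [add_apply, sub_apply, add_add_sub_cancel, ← two_smul ℂ (x v), smul_smul,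
          inv_mul_cancel₀ two_ne_zero, one_smul] at this
      · have := S.domain.smul_mem (2 : ℂ)⁻¹ (S.domain.sub_mem (ha v) (hb v))
        rwa [add_apply, sub_apply, add_sub_sub_cancel, ← two_smul ℂ (y v), smul_smul,
          inv_mul_cancel₀ two_ne_zero, one_smul] at this
    rw [h1]
    rcases h2 with h2 | h2 <;> rw [h2] <;> simp

theorem isQuadraticForm_hsForm (S : H →ₗ.[ℂ] K) : IsQuadraticForm (hsForm S) :=
  ⟨fun x _ r => by
    rw [hsForm_smul, enorm_sq_eq_ofReal, Complex.norm_real, Real.norm_eq_abs, sq_abs],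
    fun x _ y _ => hsForm_parallelogram S x y⟩

/-- A linear map on a finite-dimensional space is bounded, so `S` restricted to `W` is a bounded
`R`, and `Sx = Rx` is Hilbert–Schmidt. -/
theorem hsForm_lt_top_of_finiteDimensional {S : H →ₗ.[ℂ] K} {x : H →L[ℂ] H}
    (hx : hsNormSq (x : H →ₗ[ℂ] H) < ⊤) {W : Submodule ℂ H} [FiniteDimensional ℂ W]
    (hW : W ≤ S.domain) (hxW : ∀ v, x v ∈ W) : hsForm S x < ⊤ := by
  set R : W →L[ℂ] K := LinearMap.toContinuousLinearMap (S.toFun ∘ₗ Submodule.inclusion hW)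
  set A : H →L[ℂ] K := R ∘L x.codRestrict W hxW
  have hA : ∀ v, (x v, A v) ∈ S.graph := fun v => S.mem_graph ⟨x v, hW (hxW v)⟩
  rw [hsForm_eq_hsNormSq (A := (A : H →ₗ[ℂ] K)) hA]
  refine lt_of_le_of_lt (hsNormSq_mono (C := ‖R‖ₑ ^ 2) (B := x) fun v => ?_)
    (ENNReal.mul_lt_top (by simp) hx)
  rw [← mul_pow]
  gcongr
  exact R.le_opENorm (x.codRestrict W hxW v)

end forms

/-! ### Finite-dimensional approximation and diagonalization. -/

section approximation

variable {H : Type*} [NormedAddCommGroup H] [InnerProductSpace ℂ H] [CompleteSpace H]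

theorem enorm_sub_starProjection_le (W : Submodule ℂ H) [W.HasOrthogonalProjection] (v : H)
    {w : H} (hw : w ∈ W) : ‖v - W.starProjection v‖ₑ ≤ ‖v - w‖ₑ := by
  have h : v - W.starProjection v = Wᗮ.starProjection (v - w) := by
    rw [Submodule.starProjection_orthogonal_val, map_sub,
      Submodule.starProjection_eq_self_iff.2 hw]
    abel
  rw [h, ← ofReal_norm, ← ofReal_norm]
  exact ENNReal.ofReal_le_ofReal (Wᗮ.norm_starProjection_apply_le _)

/-- All but finitely many of the vectors `x b_i` contribute a small tail, and the remaining ones are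
approximated by vectors of the dense subspace `D`, whose span is `W`. Projection onto `W` is the
best approximation, so it does at least as well as these vectors, and on the tail at least as well
as `0`. -/
theorem exists_finiteDimensional_hsNormSq_sub_lt {x : H →L[ℂ] H}
    (hx : hsNormSq (x : H →ₗ[ℂ] H) < ⊤) {D : Submodule ℂ H} (hD : Dense (D : Set H))
    {ε : ℝ≥0∞} (hε : 0 < ε) : ∃ (W : Submodule ℂ H) (_ : FiniteDimensional ℂ W), W ≤ D ∧
      hsNormSq ((x - W.starProjection ∘L x : H →L[ℂ] H) : H →ₗ[ℂ] H) < ε := by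
  classical
  obtain ⟨_, b, -⟩ := exists_hilbertBasis ℂ H
  obtain ⟨δ, hδ, hδε, hδt⟩ : ∃ δ : ℝ≥0∞, 0 < δ ∧ δ < ε ∧ δ ≠ ⊤ := by
    obtain ⟨δ, h1, h2⟩ := exists_between hε
    exact ⟨δ, h1, h2, h2.ne_top⟩
  rw [hsNormSq_eq_tsum b] at hx
  have htail := (tendsto_order.1 (ENNReal.tendsto_tsum_compl_atTop_zero hx.ne)).2 (δ / 2)
    (ENNReal.half_pos hδ.ne')
  obtain ⟨s, hs⟩ := htail.exists
  -- The error allowed per vector, so that the `s.card` errors add up to at most `δ / 2`; the `+ 1`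
  -- keeps the divisor nonzero when `s` is empty.
  set η : ℝ≥0∞ := δ / 2 / (s.card + 1) with hη
  have hη0 : 0 < η := ENNReal.div_pos (ENNReal.half_pos hδ.ne').ne' (by simp)
  have hw : ∀ v : H, ∃ w ∈ D, ‖v - w‖ₑ ^ 2 < η := by
    intro v
    have ho : IsOpen {w : H | ‖v - w‖ₑ ^ 2 < η} :=
      isOpen_lt (by fun_prop) continuous_const
    obtain ⟨w, hw, hwD⟩ := hD.exists_mem_open ho ⟨v, by simpa using hη0⟩
    exact ⟨w, hw, hwD⟩
  choose w hwD hwη using hw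
  set W : Submodule ℂ H := Submodule.span ℂ ((s.image fun i => w (x (b i)) : Finset H) : Set H)
  have hfin : FiniteDimensional ℂ W := FiniteDimensional.span_finset ℂ _
  refine ⟨W, hfin, ?_, lt_of_le_of_lt ?_ hδε⟩
  · refine Submodule.span_le.2 fun v hv => ?_
    obtain ⟨i, -, rfl⟩ := Finset.mem_image.1 (Finset.mem_coe.1 hv)
    exact hwD _
  · rw [hsNormSq_eq_tsum b, ← ENNReal.sum_add_tsum_compl s, ← ENNReal.add_halves δ]
    refine add_le_add ?_ (le_trans ?_ hs.le)
    · have h1 : ∀ i ∈ s, ‖(x - W.starProjection ∘L x) (b i)‖ₑ ^ 2 ≤ η := fun i hi => by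
        refine le_trans ?_ (hwη (x (b i))).le
        gcongr
        exact enorm_sub_starProjection_le W _
          (Submodule.subset_span (Finset.mem_coe.2 (Finset.mem_image_of_mem _ hi)))
      refine (Finset.sum_le_sum h1).trans ?_
      rw [Finset.sum_const, nsmul_eq_mul, hη]
      refine le_trans ?_ (ENNReal.mul_div_le (a := (s.card + 1 : ℝ≥0∞)))
      gcongr
      exact le_self_add
    · refine ENNReal.tsum_le_tsum fun i => ?_
      gcongr
      simpa using enorm_sub_starProjection_le W (x (b i)) W.zero_mem

/-- The operator norm is at most the Hilbert–Schmidt norm, so `x` is a norm limit of finite-rank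
operators. -/
theorem isCompactOperator_of_hsNormSq_lt_top {x : H →L[ℂ] H}
    (hx : hsNormSq (x : H →ₗ[ℂ] H) < ⊤) : IsCompactOperator x := by
  have hc : IsClosed {f : H →L[ℂ] H | IsCompactOperator f} :=
    isClosed_setOfPred_isCompactOperator
  refine hc.closure_subset (Metric.mem_closure_iff.2 fun ε hε => ?_)
  obtain ⟨W, hW, -, h⟩ := exists_finiteDimensional_hsNormSq_sub_lt hx (D := ⊤) dense_univ
    (ε := ENNReal.ofReal ((ε / 2) ^ 2)) (by positivity)
  refine ⟨W.starProjection ∘L x, ?_, ?_⟩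
  · have : ProperSpace W := FiniteDimensional.proper ℂ W
    exact (isCompactOperator_of_locallyCompactSpace_rng W.subtypeL).comp_clm
      (W.orthogonalProjectionOnto ∘L x)
  · rw [dist_eq_norm]
    refine lt_of_le_of_lt (ContinuousLinearMap.opNorm_le_bound _ (half_pos hε).le fun v => ?_)
      (half_lt_self hε)
    have h1 := (enorm_sq_apply_le_hsNormSq _ v).trans (mul_le_mul_left h.le (‖v‖ₑ ^ 2))
    rw [enorm_sq_eq_ofReal, enorm_sq_eq_ofReal, ← ENNReal.ofReal_mul (by positivity),
      ENNReal.ofReal_le_ofReal_iff (by positivity), ← mul_pow] at h1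
    exact (abs_le_of_sq_le_sq' h1 (by positivity)).2

theorem dense_formDomain_hsForm {K : Type*} [NormedAddCommGroup K] [InnerProductSpace ℂ K]
    [CompleteSpace K] {S : H →ₗ.[ℂ] K} (hS : Dense (S.domain : Set H)) {x : H →L[ℂ] H}
    (hx : x ∈ L2h H) {ε : ℝ≥0∞} (hε : 0 < ε) : ∃ y ∈ formDomain (hsForm S),
      hsNormSq ((x - y : H →L[ℂ] H) : H →ₗ[ℂ] H) < ε := by
  obtain ⟨W, hW, hWS, h⟩ := exists_finiteDimensional_hsNormSq_sub_lt hx.2 hS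
    (ε := ε / 4) (ENNReal.div_pos hε.ne' (by simp))
  set P := W.starProjection
  have hP : IsSelfAdjoint P := isSelfAdjoint_starProjection W
  set y : H →L[ℂ] H := P ∘L x ∘L P
  have hPle : ∀ v, ‖P v‖ₑ ^ 2 ≤ 1 * ‖v‖ₑ ^ 2 := fun v => by
    rw [one_mul, ← ofReal_norm, ← ofReal_norm]
    gcongr
    exact W.norm_starProjection_apply_le v
  have hxa : x.adjoint = x := hx.1
  have hPa : P.adjoint = P := hP
  have hadj : (x - P ∘L x).adjoint = x - x ∘L P := by
    rw [map_sub, ContinuousLinearMap.adjoint_comp, hxa, hPa]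
  have hxP : hsNormSq ((x - x ∘L P : H →L[ℂ] H) : H →ₗ[ℂ] H) < ε / 4 := by
    rw [← hadj, hsNormSq_adjoint]
    exact h
  have hdiff : hsNormSq ((x - y : H →L[ℂ] H) : H →ₗ[ℂ] H) < ε := by
    have e : x - y = (x - P ∘L x) + P ∘L (x - x ∘L P) := by
      ext v
      simp [y]
    rw [e]
    refine (hsNormSq_add_le _ _).trans_lt ?_
    have h2 : hsNormSq ((P ∘L (x - x ∘L P) : H →L[ℂ] H) : H →ₗ[ℂ] H) < ε / 4 := by
      refine lt_of_le_of_lt (hsNormSq_mono (C := 1) fun v => ?_) ((one_mul _).trans_lt hxP)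
      exact hPle _
    refine (ENNReal.add_lt_add (ENNReal.mul_lt_mul_right (by simp) (by simp) h)
      (ENNReal.mul_lt_mul_right (by simp) (by simp) h2)).trans_le (le_of_eq ?_)
    rw [← add_mul, mul_comm]
    norm_num
    exact ENNReal.div_mul_cancel (by simp) (by simp)
  have hfin : hsNormSq (y : H →ₗ[ℂ] H) < ⊤ := by
    have e : y = x - (x - y) := by abel
    rw [e]
    refine (hsNormSq_add_lt_top hx.2 (B := ((x - y : H →L[ℂ] H) : H →ₗ[ℂ] H)) ?_).2
    exact hdiff.trans_le le_top
  refine ⟨y, ⟨⟨?_, hfin⟩, ?_⟩, hdiff⟩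
  · change y.adjoint = y
    simp only [y, ContinuousLinearMap.adjoint_comp, hxa, hPa, ContinuousLinearMap.comp_assoc]
  · exact hsForm_lt_top_of_finiteDimensional hfin hWS fun v => W.starProjection_apply_mem _

/-- The union of Hilbert bases of all eigenspaces, the kernel included. It is orthonormal because
distinct eigenspaces are orthogonal, and total because the eigenspaces of a compact symmetric
operator have no common orthogonal vector. -/
theorem exists_hilbertBasis_eigenvectors.{u} {H : Type u} [NormedAddCommGroup H]
    [InnerProductSpace ℂ H] [CompleteSpace H] {x : H →L[ℂ] H} (hx : x ∈ L2h H) :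
    ∃ (ι : Type u) (b : HilbertBasis ι ℂ H) (μ : ι → ℝ), ∀ i, x (b i) = (μ i : ℂ) • b i := by
  have hT : (x : H →ₗ[ℂ] H).IsSymmetric := hx.1.isSymmetric
  have hc : IsCompactOperator x := isCompactOperator_of_hsNormSq_lt_top hx.2
  have hclosed : ∀ z : ℂ, CompleteSpace (Module.End.eigenspace (x : H →ₗ[ℂ] H) z) := by
    intro z
    have : IsClosed (Module.End.eigenspace (x : H →ₗ[ℂ] H) z : Set H) := by
      have e : (Module.End.eigenspace (x : H →ₗ[ℂ] H) z : Set H) = {v | x v = z • v} := by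
        ext v
        simp [Module.End.mem_eigenspace_iff]
      rw [e]
      exact isClosed_eq x.continuous (continuous_const_smul z)
    exact this.completeSpace_coe
  choose w b hb using fun z : ℂ =>
    exists_hilbertBasis ℂ (Module.End.eigenspace (x : H →ₗ[ℂ] H) z)
  have ho := hT.orthogonalFamily_eigenspaces.orthonormal_sigma_orthonormal
    (v_family := fun z => b z) fun z => (b z).orthonormal
  refine ⟨_, HilbertBasis.mkOfOrthogonalEqBot ho ?_, fun i => i.1.re, fun i => ?_⟩
  · rw [eq_bot_iff, 
      ← ContinuousLinearMap.orthogonalComplement_iSup_eigenspaces_eq_bot hc hT,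
      ← Submodule.iInf_orthogonal]
    refine le_iInf fun z u hu => ?_
    -- By Parseval inside one eigenspace, a vector orthogonal to its chosen basis has zero
    -- projection there.
    rw [← Submodule.orthogonalProjectionOnto_eq_zero_iff]
    rw [← enorm_eq_zero, ← sq_eq_zero_iff (M₀ := ℝ≥0∞), ← (b z).tsum_enorm_inner_sq]
    refine ENNReal.tsum_eq_zero.2 fun i => ?_
    have h0 : ⟪((b z i : _) : H), u⟫_ℂ = 0 :=
      hu _ (Submodule.subset_span ⟨⟨z, i⟩, rfl⟩)
    rw [Submodule.inner_orthogonalProjectionOnto_eq_of_mem_left, h0]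
    simp
  · rw [HilbertBasis.coe_mkOfOrthogonalEqBot]
    have h1 : x (b i.1 i.2 : H) = i.1 • (b i.1 i.2 : H) :=
      Module.End.mem_eigenspace_iff.1 (b i.1 i.2).2
    have hne : (b i.1 i.2 : H) ≠ 0 := by
      have := ((b i.1).orthonormal).ne_zero i.2
      simpa using this
    have h2 := hT.conj_eigenvalue_eq_self
      (Module.End.hasEigenvalue_of_hasEigenvector ⟨(b i.1 i.2).2, hne⟩)
    rw [Complex.conj_eq_iff_re.1 h2]
    exact h1

end approximation

/-! ### Lipschitz functional calculus and the contraction property. -/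

section contraction

variable {H K : Type*} [NormedAddCommGroup H] [InnerProductSpace ℂ H] [CompleteSpace H]
  [NormedAddCommGroup K] [InnerProductSpace ℂ K] [CompleteSpace K]

/-- Since `‖k(x) v‖² = ⟪k²(x) v, v⟫`, this is monotonicity of the functional calculus for `f² ≤ g²`.
-/
theorem norm_cfc_apply_le_of_abs_le {x : H →L[ℂ] H} {f g : ℝ → ℝ}
    (hf : Continuous f) (hg : Continuous g) (h : ∀ t, |f t| ≤ |g t|) (v : H) :
    ‖cfc f x v‖ ≤ ‖cfc g x v‖ := by
  have key : ∀ k : ℝ → ℝ, Continuous k →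
      ‖cfc k x v‖ ^ 2 = RCLike.re ⟪cfc (fun t => k t * k t) x v, v⟫_ℂ := by
    intro k hk
    have hs : (cfc k x).adjoint = cfc k x := (cfc_predicate k x : IsSelfAdjoint (cfc k x))
    rw [cfc_mul k k x hk.continuousOn hk.continuousOn, mul_apply_eq_comp,
      ← ContinuousLinearMap.adjoint_inner_right, hs, inner_self_eq_norm_sq]
  have hle : cfc (fun t => f t * f t) x ≤ cfc (fun t => g t * g t) x := by
    refine cfc_mono (fun t _ => ?_) (by fun_prop) (by fun_prop)
    rw [← abs_mul_abs_self (f t), ← abs_mul_abs_self (g t)]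
    exact mul_self_le_mul_self (abs_nonneg _) (h t)
  have hpos := (ContinuousLinearMap.le_def _ _).1 hle
  have h2 := hpos.re_inner_nonneg_left v
  rw [sub_apply, inner_sub_left, map_sub, ← key f hf, ← key g hg] at h2
  exact (abs_le_of_sq_le_sq' (by linarith) (norm_nonneg _)).2

/-- The scalar bound `|f t - f a| ≤ C |t - a|` transferred to `x`. At an eigenvalue `a` it forces
`f(x) v = f(a) v`; at `a = 0` with `f 0 = 0` it shows that `f(x)` is Hilbert–Schmidt. -/
theorem norm_cfc_apply_le {x : H →L[ℂ] H} (hx : IsSelfAdjoint x) {f : ℝ → ℝ} {C : ℝ≥0}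
    (hf : LipschitzWith C f) (a : ℝ) (v : H) :
    ‖cfc f x v - (f a : ℂ) • v‖ ≤ C * ‖x v - (a : ℂ) • v‖ := by
  have h := norm_cfc_apply_le_of_abs_le (x := x) (f := fun t => f t - f a) (g := fun t => C * (t - a))
    (hf.continuous.sub continuous_const) (by fun_prop) (fun t => by
      rw [abs_mul, NNReal.abs_eq]
      exact hf.dist_le_mul t a) v
  rw [cfc_sub f (fun _ => f a) x hf.continuous.continuousOn, cfc_const_mul (C : ℝ) (fun t => t - a) x,
    cfc_sub (fun t => t) (fun _ => a) x, cfc_const (f a) x,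
    cfc_const a x, cfc_id' ℝ x] at h
  simp only [sub_apply, smul_apply, Algebra.algebraMap_eq_smul_one, one_apply, norm_smul] at h
  simpa using h

theorem cfc_apply_eigenvector {x : H →L[ℂ] H} (hx : IsSelfAdjoint x) {f : ℝ → ℝ} {C : ℝ≥0}
    (hf : LipschitzWith C f) {a : ℝ} {v : H} (hv : x v = (a : ℂ) • v) :
    cfc f x v = (f a : ℂ) • v := by
  have h := norm_cfc_apply_le hx hf a v
  rw [hv, sub_self, norm_zero, mul_zero] at h
  exact sub_eq_zero.1 (norm_le_zero_iff.1 h)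

theorem cfc_mem_L2h {x : H →L[ℂ] H} (hx : x ∈ L2h H) {f : ℝ → ℝ} {C : ℝ≥0}
    (hf : LipschitzWith C f) (h0 : f 0 = 0) : cfc f x ∈ L2h H := by
  refine ⟨cfc_predicate f x, lt_of_le_of_lt
    (hsNormSq_mono (C := (C : ℝ≥0∞) ^ 2) (B := x) fun v => ?_) (ENNReal.mul_lt_top (by simp) hx.2)⟩
  have h := norm_cfc_apply_le hx.1 hf 0 v
  simp only [h0, Complex.ofReal_zero, zero_smul, sub_zero] at h
  rw [← mul_pow, ← ofReal_norm, ← ofReal_norm, ← ENNReal.ofReal_coe_nnreal,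
    ← ENNReal.ofReal_mul C.coe_nonneg]
  gcongr

theorem exists_finset_tsum_ite_lt {ι : Type*} [DecidableEq ι] {F : ι → ℝ≥0∞}
    (hF : ∑' i, F i < ⊤) {ε : ℝ≥0∞} (hε : 0 < ε) :
    ∃ s : Finset ι, ∑' i, (if i ∈ s then 0 else F i) < ε := by
  obtain ⟨s, hs⟩ := ((tendsto_order.1 (ENNReal.tendsto_tsum_compl_atTop_zero hF.ne)).2 ε hε).exists
  refine ⟨s, lt_of_eq_of_lt ?_ hs⟩
  refine Eq.trans (tsum_congr fun i => ?_) (tsum_subtype {i | i ∉ s} F).symm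
  by_cases h : i ∈ s <;> simp [h]

section rankOneSum

variable {ι : Type*} [DecidableEq ι]

theorem sum_rankOne_apply_basis (b : HilbertBasis ι ℂ H) (s : Finset ι) (w : ι → K) (j : ι) :
    (∑ i ∈ s, InnerProductSpace.rankOne ℂ (w i) (b i)) (b j) = if j ∈ s then w j else 0 := by
  simp only [sum_apply, InnerProductSpace.rankOne_apply,
    orthonormal_iff_ite.1 b.orthonormal, ite_smul, one_smul, zero_smul]
  simp

theorem sum_rankOne_mem_graph {S : H →ₗ.[ℂ] K} (b : ι → H) (s : Finset ι)
    {w : ι → H} {g : ι → K} (h : ∀ i, (w i, g i) ∈ S.graph) (v : H) :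
    ((∑ i ∈ s, InnerProductSpace.rankOne ℂ (w i) (b i)) v,
      (∑ i ∈ s, InnerProductSpace.rankOne ℂ (g i) (b i)) v) ∈ S.graph := by
  have : ∑ i ∈ s, ⟪b i, v⟫_ℂ • (w i, g i) ∈ S.graph :=
    S.graph.sum_mem fun i _ => S.graph.smul_mem _ (h i)
  convert this using 1
  ext <;> simp [Prod.fst_sum, Prod.snd_sum]

theorem isSelfAdjoint_sum_rankOne (b : ι → H) (s : Finset ι) (r : ι → ℝ) :
    IsSelfAdjoint (∑ i ∈ s, InnerProductSpace.rankOne ℂ ((r i : ℂ) • b i) (b i)) := by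
  refine isSelfAdjoint_sum s fun i _ => ?_
  change ContinuousLinearMap.adjoint _ = _
  rw [InnerProductSpace.adjoint_rankOne]
  ext v
  simp only [InnerProductSpace.rankOne_apply, inner_smul_left, Complex.conj_ofReal, smul_smul,
    mul_comm]

end rankOneSum

theorem hsForm_cfc_le {S : H →ₗ.[ℂ] K} (hS : IsClosedForm (hsForm S)) {f : ℝ → ℝ} {C : ℝ≥0}
    (hf : LipschitzWith C f) (h0 : f 0 = 0) {x : H →L[ℂ] H} (hx : x ∈ formDomain (hsForm S)) :
    cfc f x ∈ formDomain (hsForm S) ∧ hsForm S (cfc f x) ≤ (C : ℝ≥0∞) ^ 2 * hsForm S x := by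
  classical
  obtain ⟨ι, b, μ, hb⟩ := exists_hilbertBasis_eigenvectors hx.1
  obtain ⟨A, hA⟩ := exists_lift_of_hsForm_lt_top hx.2
  have hEA : hsForm S x = ∑' i, ‖A (b i)‖ₑ ^ 2 := by
    rw [hsForm_eq_hsNormSq (A := (A : H →ₗ[ℂ] K)) hA, hsNormSq_eq_tsum b]
  have hy : cfc f x ∈ L2h H := cfc_mem_L2h hx.1 hf h0
  have hyb : ∀ i, cfc f x (b i) = (f (μ i) : ℂ) • b i := fun i =>
    cfc_apply_eigenvector hx.1.1 hf (hb i)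
  -- The value of `S` at `f(μ_i) b_i`. When `μ i = 0` the quotient is `0` by convention, which is
  -- the right value because `f 0 = 0`.
  set g : ι → K := fun i => ((f (μ i) / μ i : ℝ) : ℂ) • A (b i) with hg
  have hgraph : ∀ i, ((f (μ i) : ℂ) • b i, g i) ∈ S.graph := by
    intro i
    have h := S.graph.smul_mem ((f (μ i) / μ i : ℝ) : ℂ) (hA (b i))
    rw [Prod.smul_mk, hb, smul_smul, ← Complex.ofReal_mul] at h
    rcases eq_or_ne (μ i) 0 with h' | h'
    · simp [hg, h', h0]
    · rwa [div_mul_cancel₀ _ h'] at h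
  have hgle : ∀ i, ‖g i‖ₑ ^ 2 ≤ (C : ℝ≥0∞) ^ 2 * ‖A (b i)‖ₑ ^ 2 := by
    intro i
    rw [← mul_pow, hg, enorm_smul]
    gcongr
    rw [← ofReal_norm, Complex.norm_real, ← ENNReal.ofReal_coe_nnreal, norm_div]
    refine ENNReal.ofReal_le_ofReal (div_le_of_le_mul₀ (norm_nonneg _) C.2 ?_)
    simpa [h0, Real.dist_eq] using hf.dist_le_mul (μ i) 0
  -- One summable majorant for both `‖f(x) b_i‖²` and `‖g i‖²`: its tails `T` control
  -- Hilbert–Schmidt convergence and the `E`-Cauchy property together.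
  set F : ι → ℝ≥0∞ := fun i => ‖cfc f x (b i)‖ₑ ^ 2 + (C : ℝ≥0∞) ^ 2 * ‖A (b i)‖ₑ ^ 2 with hF
  have hFsum : ∑' i, F i < ⊤ := by
    rw [hF, ENNReal.tsum_add, ENNReal.tsum_mul_left, ← hsNormSq_eq_tsum b, ← hEA]
    exact ENNReal.add_lt_top.2 ⟨hy.2, ENNReal.mul_lt_top (by simp) hx.2⟩
  set T : Finset ι → ℝ≥0∞ := fun s => ∑' i, if i ∈ s then 0 else F i with hT
  -- Closedness is tested on sequences while `ι` may be uncountable, so a sequence of finite sets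
  -- with vanishing tails is extracted.
  choose s hs using fun k : ℕ => exists_finset_tsum_ite_lt hFsum
    (ε := ((k : ℝ≥0∞) + 1)⁻¹) (ENNReal.inv_pos.2 (by finiteness))
  have hT0 : Tendsto (fun k => T (s k)) atTop (𝓝 0) := by
    refine tendsto_of_tendsto_of_tendsto_of_le_of_le tendsto_const_nhds
      ((tendsto_add_atTop_iff_nat 1).2 ENNReal.tendsto_inv_nat_nhds_zero) (fun _ => zero_le)
      fun k => ?_
    simpa using (hs k).le
  set u : Finset ι → H →L[ℂ] H := fun t =>
    ∑ i ∈ t, InnerProductSpace.rankOne ℂ ((f (μ i) : ℂ) • b i) (b i)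
  set G : Finset ι → H →L[ℂ] K := fun t => ∑ i ∈ t, InnerProductSpace.rankOne ℂ (g i) (b i)
  have hub : ∀ t j, u t (b j) = if j ∈ t then cfc f x (b j) else 0 := fun t j => by
    rw [hyb]
    exact sum_rankOne_apply_basis b t _ j
  have hGb : ∀ t j, G t (b j) = if j ∈ t then g j else 0 := fun t j =>
    sum_rankOne_apply_basis b t _ j
  have huG : ∀ t v, (u t v, G t v) ∈ S.graph := fun t v => sum_rankOne_mem_graph b t hgraph v
  have hudom : ∀ t, u t ∈ formDomain (hsForm S) := by
    intro t
    refine ⟨⟨isSelfAdjoint_sum_rankOne _ _ _, ?_⟩, ?_⟩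
    · rw [hsNormSq_eq_tsum b]
      refine (ENNReal.tsum_le_tsum fun i => ?_).trans_lt hFsum
      rw [hub]
      split_ifs
      · exact le_self_add
      · simp
    · rw [hsForm_eq_hsNormSq (A := (G t : H →ₗ[ℂ] K)) (huG t), hsNormSq_eq_tsum b]
      refine (ENNReal.tsum_le_tsum fun i => ?_).trans_lt hFsum
      rw [hGb]
      split_ifs
      · exact (hgle i).trans le_add_self
      · simp
  have h1 : ∀ t, hsNormSq ((u t - cfc f x : H →L[ℂ] H) : H →ₗ[ℂ] H) ≤ T t := by
    intro t
    rw [hsNormSq_eq_tsum b]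
    refine ENNReal.tsum_le_tsum fun i => ?_
    rw [sub_apply, hub]
    split_ifs
    · simp
    · rw [zero_sub, enorm_neg]
      exact le_self_add
  -- Indices lying in both sets cancel or those in neither give `0`; every other index lies outside
  -- `t` or outside `t'`.
  have h2 : ∀ t t', hsForm S (u t - u t') ≤ T t + T t' := by
    intro t t'
    rw [hsForm_eq_hsNormSq (A := ((G t - G t' : H →L[ℂ] K) : H →ₗ[ℂ] K))
      (fun v => S.graph.sub_mem (huG t v) (huG t' v)), hsNormSq_eq_tsum b, hT, ← ENNReal.tsum_add]
    refine ENNReal.tsum_le_tsum fun i => ?_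
    rw [sub_apply, hGb, hGb]
    have h3 : ‖g i‖ₑ ^ 2 ≤ F i := (hgle i).trans le_add_self
    split_ifs <;> simp [h3]
  obtain ⟨hdom, -⟩ := hS (fun k => u (s k)) (cfc f x) (fun k => hudom _) hy
    (tendsto_of_tendsto_of_tendsto_of_le_of_le tendsto_const_nhds hT0 (fun _ => zero_le)
      fun k => h1 _)
    (tendsto_of_tendsto_of_tendsto_of_le_of_le tendsto_const_nhds
      (g := fun _ => (0 : ℝ≥0∞)) (h := fun p : ℕ × ℕ => T (s p.1) + T (s p.2)) (by
        rw [← prod_atTop_atTop_eq]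
        simpa using (hT0.comp tendsto_fst).add (hT0.comp tendsto_snd)) (fun _ => zero_le)
      fun p => h2 _ _)
  refine ⟨hdom, ?_⟩
  obtain ⟨B, hB⟩ := exists_lift_of_hsForm_lt_top hdom.2
  rw [hsForm_eq_hsNormSq (A := (B : H →ₗ[ℂ] K)) hB, hsNormSq_eq_tsum b, hEA,
    ← ENNReal.tsum_mul_left]
  refine ENNReal.tsum_le_tsum fun i => ?_
  -- The graph of `S` is single-valued, so the lift of `f(x)` is known on the eigenbasis.
  have hBg : B (b i) = g i :=
    S.mem_graph_snd_inj (hB (b i)) (hgraph i) (hyb i)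
  rw [hBg]
  exact hgle i

theorem isDirichletForm_hsForm {S : H →ₗ.[ℂ] K} (hd : Dense (S.domain : Set H))
    (hS : IsClosedForm (hsForm S)) : IsDirichletForm (hsForm S) where
  quadratic := isQuadraticForm_hsForm S
  closed := hS
  dense _ hx _ hε := dense_formDomain_hsForm hd hx hε
  contraction _ _ hf h0 _ hx := hsForm_cfc_le hS hf h0 hx

end contraction

/-! ### Operators on `Hᵐ` and the complete Dirichlet property. -/

section amplification

variable {H K : Type*} [NormedAddCommGroup H] [InnerProductSpace ℂ H] [CompleteSpace H]
  [NormedAddCommGroup K] [InnerProductSpace ℂ K] [CompleteSpace K] {m : ℕ}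

variable (H) in
/-- The inclusion of the `j`-th summand of `Hᵐ`. -/
def amplSingle (j : Fin m) : H →L[ℂ] AmplSpace H m :=
  (PiLp.continuousLinearEquiv 2 ℂ fun _ : Fin m => H).symm.toContinuousLinearMap ∘L
    ContinuousLinearMap.single ℂ (fun _ : Fin m => H) j

variable (H) in
/-- The projection onto the `i`-th summand of `Hᵐ`. -/
abbrev amplProj (i : Fin m) : AmplSpace H m →L[ℂ] H := PiLp.proj 2 (fun _ : Fin m => H) i

theorem amplEntry_eq (x : AmplSpace H m →L[ℂ] AmplSpace H m) (i j : Fin m) :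
    amplEntry x i j = amplProj H i ∘L x ∘L amplSingle H j := rfl

theorem amplSingle_apply (j : Fin m) (v : H) (i : Fin m) :
    (amplSingle H j v) i = if i = j then v else 0 := by
  change Pi.single (M := fun _ : Fin m => H) j v i = _
  rw [Pi.single_apply]

theorem sum_amplSingle (v : AmplSpace H m) : ∑ j, amplSingle H j (v j) = v := by
  ext i
  simp [amplSingle_apply]

theorem adjoint_amplSingle (j : Fin m) : (amplSingle H j).adjoint = amplProj H j := by
  symm
  rw [ContinuousLinearMap.eq_adjoint_iff]
  intro v w
  simp [PiLp.inner_apply, amplSingle_apply, apply_ite, Finset.sum_ite_eq']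

theorem adjoint_amplProj (j : Fin m) : (amplProj H j).adjoint = amplSingle H j := by
  rw [← adjoint_amplSingle, ContinuousLinearMap.adjoint_adjoint]

theorem hsNormSq_eq_sum_amplProj (A : H →L[ℂ] AmplSpace K m) :
    hsNormSq (A : H →ₗ[ℂ] AmplSpace K m) =
      ∑ i, hsNormSq ((amplProj K i ∘L A : H →L[ℂ] K) : H →ₗ[ℂ] K) := by
  obtain ⟨_, b, -⟩ := exists_hilbertBasis ℂ H
  simp only [hsNormSq_eq_tsum b]
  rw [← Summable.tsum_finsetSum fun _ _ => ENNReal.summable]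
  refine tsum_congr fun k => ?_
  simp only [enorm_sq_eq_ofReal]
  rw [PiLp.norm_sq_eq_of_L2, ENNReal.ofReal_sum_of_nonneg fun i _ => by positivity]
  rfl

/-- Passing to adjoints exchanges inclusions and projections, so no basis of `Hᵐ` has to be built.
-/
theorem hsNormSq_eq_sum_amplSingle (A : AmplSpace H m →L[ℂ] K) :
    hsNormSq (A : AmplSpace H m →ₗ[ℂ] K) =
      ∑ j, hsNormSq ((A ∘L amplSingle H j : H →L[ℂ] K) : H →ₗ[ℂ] K) := by
  rw [← hsNormSq_adjoint, hsNormSq_eq_sum_amplProj]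
  refine Finset.sum_congr rfl fun j _ => ?_
  rw [← hsNormSq_adjoint (A ∘L amplSingle H j), ContinuousLinearMap.adjoint_comp,
    adjoint_amplSingle]

theorem hsNormSq_eq_sum_entries (A : AmplSpace H m →L[ℂ] AmplSpace K m) :
    hsNormSq (A : AmplSpace H m →ₗ[ℂ] AmplSpace K m) =
      ∑ i, ∑ j, hsNormSq ((amplProj K i ∘L A ∘L amplSingle H j : H →L[ℂ] K) : H →ₗ[ℂ] K) := by
  rw [hsNormSq_eq_sum_amplProj]
  exact Finset.sum_congr rfl fun i _ => hsNormSq_eq_sum_amplSingle _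

/-- The direct sum of `m` copies of an unbounded operator. -/
def amplOperator (S : H →ₗ.[ℂ] K) (m : ℕ) : AmplSpace H m →ₗ.[ℂ] AmplSpace K m where
  domain :=
    { carrier := {v | ∀ i, v i ∈ S.domain}
      add_mem' := fun hv hw i => S.domain.add_mem (hv i) (hw i)
      zero_mem' := fun _ => S.domain.zero_mem
      smul_mem' := fun z _ hv i => S.domain.smul_mem z (hv i) }
  toFun :=
    { toFun := fun v => WithLp.toLp 2 fun i => S ⟨v.1 i, v.2 i⟩
      map_add' := fun v w => by
        ext i
        exact S.map_add ⟨v.1 i, v.2 i⟩ ⟨w.1 i, w.2 i⟩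
      map_smul' := fun z v => by
        ext i
        exact S.map_smul z ⟨v.1 i, v.2 i⟩ }

theorem mem_graph_amplOperator {S : H →ₗ.[ℂ] K} {v : AmplSpace H m} {w : AmplSpace K m} :
    (v, w) ∈ (amplOperator S m).graph ↔ ∀ i, (v i, w i) ∈ S.graph := by
  constructor
  · intro h i
    obtain ⟨y, hy, hw⟩ := LinearPMap.mem_graph_iff _ |>.1 h
    simp only at hy hw
    subst hy hw
    exact S.mem_graph ⟨y.1 i, y.2 i⟩
  · intro h
    have hd : ∀ i, v i ∈ S.domain := fun i => LinearPMap.mem_domain_of_mem_graph (h i)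
    refine (LinearPMap.mem_graph_iff _).2 ⟨⟨v, hd⟩, rfl, ?_⟩
    ext i
    exact ((LinearPMap.image_iff (hd i)).2 (h i)).symm

theorem dense_domain_amplOperator {S : H →ₗ.[ℂ] K} (hS : Dense (S.domain : Set H)) :
    Dense ((amplOperator S m).domain : Set (AmplSpace H m)) := by
  have h := (dense_pi (α := fun _ : Fin m => H) Set.univ fun _ _ => hS).preimage
    (PiLp.continuousLinearEquiv 2 ℂ fun _ : Fin m => H).toHomeomorph.isOpenMap
  refine h.mono fun v hv i => ?_
  exact hv i trivial

theorem hsForm_amplOperator (S : H →ₗ.[ℂ] K) (x : AmplSpace H m →L[ℂ] AmplSpace H m) :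
    hsForm (amplOperator S m) x = ∑ i, ∑ j, hsForm S (amplEntry x i j) := by
  have key : ∀ B : AmplSpace H m →L[ℂ] AmplSpace K m,
      (∀ v, (x v, B v) ∈ (amplOperator S m).graph) →
      hsForm (amplOperator S m) x = ∑ i, ∑ j, hsForm S (amplEntry x i j) := by
    intro B hB
    rw [hsForm_eq_hsNormSq (A := (B : AmplSpace H m →ₗ[ℂ] AmplSpace K m)) hB,
      hsNormSq_eq_sum_entries]
    refine Finset.sum_congr rfl fun i _ => Finset.sum_congr rfl fun j _ => ?_
    rw [hsForm_eq_hsNormSq (A := ((amplProj K i ∘L B ∘L amplSingle H j : H →L[ℂ] K) :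
      H →ₗ[ℂ] K))]
    exact fun v => mem_graph_amplOperator.1 (hB (amplSingle H j v)) i
  -- By `key` any bounded lift of `x` suffices. Finiteness of the left side provides one, and if all
  -- entries have finite form their lifts are assembled into a matrix; otherwise both sides are
  -- infinite.
  rcases eq_or_ne (hsForm (amplOperator S m) x) ⊤ with h | h
  · rcases eq_or_ne (∑ i, ∑ j, hsForm S (amplEntry x i j)) ⊤ with h' | h'
    · rw [h, h']
    · have hlt : ∀ i j, hsForm S (amplEntry x i j) < ⊤ := fun i j =>
        ENNReal.sum_lt_top.1 (ENNReal.sum_lt_top.1 (lt_top_iff_ne_top.2 h') i (Finset.mem_univ _))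
          j (Finset.mem_univ _)
      choose B hB using fun i j => exists_lift_of_hsForm_lt_top (hlt i j)
      refine key (∑ i, ∑ j, amplSingle K i ∘L B i j ∘L amplProj H j) fun v => ?_
      refine mem_graph_amplOperator.2 fun i => ?_
      have h1 := S.graph.sum_mem (t := Finset.univ) fun j _ => hB i j (v j)
      convert h1 using 1
      ext
      · rw [Prod.fst_sum]
        conv_lhs => rw [← sum_amplSingle v]
        simp [amplEntry_eq]
      · rw [Prod.snd_sum]
        simp [amplSingle_apply]
  · obtain ⟨B, hB⟩ := exists_lift_of_hsForm_lt_top (lt_top_iff_ne_top.2 h)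
    exact key B hB

theorem amplEntry_star {x : AmplSpace H m →L[ℂ] AmplSpace H m} (hx : IsSelfAdjoint x)
    (i j : Fin m) : amplEntry x j i = star (amplEntry x i j) := by
  have hx' : x.adjoint = x := hx
  change _ = (amplEntry x i j).adjoint
  rw [amplEntry_eq, amplEntry_eq, ContinuousLinearMap.adjoint_comp,
    ContinuousLinearMap.adjoint_comp, hx', adjoint_amplSingle, adjoint_amplProj]
  rfl

/-- With `a = Re y` and `b = Im y`, `y = a + ib` and `y* = a - ib`, so this is the parallelogram law
for `a` and `ib`. -/
theorem hsForm_add_hsForm_star (S : H →ₗ.[ℂ] K) (y : H →L[ℂ] H) :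
    hsForm S y + hsForm S (star y) =
      2 * (hsForm S (ℜ y : H →L[ℂ] H) + hsForm S (ℑ y : H →L[ℂ] H)) := by
  have h1 : y = (ℜ y : H →L[ℂ] H) + Complex.I • (ℑ y : H →L[ℂ] H) :=
    (realPart_add_I_smul_imaginaryPart y).symm
  have h2 : star y = (ℜ y : H →L[ℂ] H) - Complex.I • (ℑ y : H →L[ℂ] H) := by
    conv_lhs => rw [h1]
    rw [star_add, star_smul, selfAdjoint.star_val_eq, selfAdjoint.star_val_eq]
    simp [sub_eq_add_neg]
  have h3 := hsForm_parallelogram S (ℜ y : H →L[ℂ] H) (Complex.I • (ℑ y : H →L[ℂ] H))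
  rw [← h1, ← h2, hsForm_smul] at h3
  rw [h3, mul_add, ← ofReal_norm, Complex.norm_I, ENNReal.ofReal_one, one_pow, one_mul]

/-- Self-adjointness gives `x_ji = x_ij*`, so after doubling, the entries `(i, j)` and `(j, i)`
combine into real and imaginary parts. -/
theorem hsForm_amplOperator_eq_amplForm (S : H →ₗ.[ℂ] K)
    {x : AmplSpace H m →L[ℂ] AmplSpace H m} (hx : IsSelfAdjoint x) :
    hsForm (amplOperator S m) x = amplForm (hsForm S) m x := by
  rw [hsForm_amplOperator, ← ENNReal.mul_right_inj (a := 2) two_ne_zero (by simp)]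
  have h : ∀ i j, 2 * (hsForm S (ℜ (amplEntry x i j) : H →L[ℂ] H) +
      hsForm S (ℑ (amplEntry x i j) : H →L[ℂ] H)) =
      hsForm S (amplEntry x i j) + hsForm S (amplEntry x j i) := fun i j => by
    rw [amplEntry_star hx i j, hsForm_add_hsForm_star]
  have h2 : 2 * amplForm (hsForm S) m x =
      ∑ i, ∑ j, (hsForm S (amplEntry x i j) + hsForm S (amplEntry x j i)) := by
    simp only [amplForm, Finset.mul_sum, h]
  rw [h2, two_mul]
  simp only [Finset.sum_add_distrib]
  congr 1
  exact Finset.sum_comm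

variable (H) in
theorem mem_graph_toPMap_id (v : H) : (v, v) ∈ ((LinearMap.id : H →ₗ[ℂ] H).toPMap ⊤).graph :=
  (LinearPMap.mem_graph_iff _).2 ⟨⟨v, trivial⟩, rfl, rfl⟩

theorem hsForm_id (x : H →L[ℂ] H) :
    hsForm ((LinearMap.id : H →ₗ[ℂ] H).toPMap ⊤) x = hsNormSq (x : H →ₗ[ℂ] H) :=
  hsForm_eq_hsNormSq fun v => mem_graph_toPMap_id H (x v)

/-- The Hilbert–Schmidt norm is the form of the everywhere defined identity, so the preceding
comparison applies to it. -/
theorem hsNormSq_eq_amplForm {x : AmplSpace H m →L[ℂ] AmplSpace H m} (hx : IsSelfAdjoint x) :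
    hsNormSq (x : AmplSpace H m →ₗ[ℂ] AmplSpace H m) =
      amplForm (fun y : H →L[ℂ] H => hsNormSq (y : H →ₗ[ℂ] H)) m x := by
  have h := hsForm_amplOperator_eq_amplForm ((LinearMap.id : H →ₗ[ℂ] H).toPMap ⊤) hx
  have h2 : hsForm ((LinearMap.id : H →ₗ[ℂ] H).toPMap ⊤) =
      fun y : H →L[ℂ] H => hsNormSq (y : H →ₗ[ℂ] H) := funext hsForm_id
  rw [h2] at h
  rw [← h]
  have h3 : ∀ v, (x v, (x : AmplSpace H m →ₗ[ℂ] AmplSpace H m) v) ∈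
      (amplOperator ((LinearMap.id : H →ₗ[ℂ] H).toPMap ⊤) m).graph := fun v =>
    mem_graph_amplOperator.2 fun i => mem_graph_toPMap_id H ((x v) i)
  exact (hsForm_eq_hsNormSq h3).symm

theorem le_amplForm (E : (H →L[ℂ] H) → ℝ≥0∞) (x : AmplSpace H m →L[ℂ] AmplSpace H m)
    (i j : Fin m) : E (ℜ (amplEntry x i j)) + E (ℑ (amplEntry x i j)) ≤ amplForm E m x := by
  have h : ∀ F : Fin m → Fin m → ℝ≥0∞, F i j ≤ ∑ i, ∑ j, F i j := fun F =>
    (Finset.single_le_sum (f := F i) (fun _ _ => zero_le) (Finset.mem_univ j)).trans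
      (Finset.single_le_sum (f := fun i => ∑ j, F i j) (fun _ _ => zero_le) (Finset.mem_univ i))
  exact h fun i j => E (ℜ (amplEntry x i j)) + E (ℑ (amplEntry x i j))

theorem amplEntry_sub (x y : AmplSpace H m →L[ℂ] AmplSpace H m) (i j : Fin m) :
    amplEntry (x - y) i j = amplEntry x i j - amplEntry y i j := by
  simp only [amplEntry_eq, ContinuousLinearMap.sub_comp, ContinuousLinearMap.comp_sub]

theorem IsClosedForm.amplForm {E : (H →L[ℂ] H) → ℝ≥0∞} (hE : IsClosedForm E) (m : ℕ) :
    IsClosedForm (amplForm E m) := by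
  intro u x hu hx hux hE0
  -- `P` will be `y ↦ Re y_ij` or `y ↦ Im y_ij`. Such a map respects differences and increases
  -- neither the Hilbert–Schmidt norm of self-adjoint operators nor the form, so it carries the
  -- given sequence to one on which closedness of `E` can be tested.
  have key : ∀ P : (AmplSpace H m →L[ℂ] AmplSpace H m) → (H →L[ℂ] H),
      (∀ y z, P (y - z) = P y - P z) → (∀ y, IsSelfAdjoint (P y)) →
      (∀ y, IsSelfAdjoint y → hsNormSq (P y : H →ₗ[ℂ] H) ≤
        hsNormSq (y : AmplSpace H m →ₗ[ℂ] AmplSpace H m)) →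
      (∀ y, E (P y) ≤ _root_.amplForm E m y) →
      E (P x) < ⊤ ∧ Tendsto (fun k => E (P (u k - x))) atTop (𝓝 0) := by
    intro P hsub hsa hhs hEP
    have h := hE (fun k => P (u k)) (P x)
      (fun k => ⟨⟨hsa _, (hhs _ (hu k).1.1).trans_lt (hu k).1.2⟩, (hEP _).trans_lt (hu k).2⟩)
      ⟨hsa _, (hhs _ hx.1).trans_lt hx.2⟩
      (tendsto_of_tendsto_of_tendsto_of_le_of_le tendsto_const_nhds hux (fun _ => zero_le)
        fun k => by
          rw [← hsub]
          exact hhs _ ((hu k).1.1.sub hx.1))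
      (tendsto_of_tendsto_of_tendsto_of_le_of_le tendsto_const_nhds hE0 (fun _ => zero_le)
        fun p => by
          rw [← hsub]
          exact hEP _)
    refine ⟨h.1.2, ?_⟩
    simpa only [hsub] using h.2
  have hre := fun i j => key (fun y => (ℜ (amplEntry y i j) : H →L[ℂ] H))
    (fun y z => by rw [amplEntry_sub, map_sub]; rfl) (fun y => (ℜ (amplEntry y i j)).2)
    (fun y hy => by
      rw [hsNormSq_eq_amplForm hy]
      exact le_self_add.trans (le_amplForm (fun y : H →L[ℂ] H => hsNormSq (y : H →ₗ[ℂ] H)) y i j))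
    (fun y => le_self_add.trans (le_amplForm E y i j))
  have him := fun i j => key (fun y => (ℑ (amplEntry y i j) : H →L[ℂ] H))
    (fun y z => by rw [amplEntry_sub, map_sub]; rfl) (fun y => (ℑ (amplEntry y i j)).2)
    (fun y hy => by
      rw [hsNormSq_eq_amplForm hy]
      exact le_add_self.trans (le_amplForm (fun y : H →L[ℂ] H => hsNormSq (y : H →ₗ[ℂ] H)) y i j))
    (fun y => le_add_self.trans (le_amplForm E y i j))
  refine ⟨⟨hx, ENNReal.sum_lt_top.2 fun i _ => ENNReal.sum_lt_top.2 fun j _ =>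
    ENNReal.add_lt_top.2 ⟨(hre i j).1, (him i j).1⟩⟩, ?_⟩
  have h0 : (0 : ℝ≥0∞) = ∑ i : Fin m, ∑ j : Fin m, (0 + 0) := by simp
  rw [h0]
  exact tendsto_finsetSum _ fun i _ => tendsto_finsetSum _ fun j _ => (hre i j).2.add (him i j).2

section congr

variable {E E' : (H →L[ℂ] H) → ℝ≥0∞}

theorem formDomain_congr (h : ∀ x, IsSelfAdjoint x → E x = E' x) :
    formDomain E = formDomain E' := by
  ext x
  refine and_congr_right fun hx => ?_
  rw [h x hx.1]

theorem IsClosedForm.congr (h : ∀ x, IsSelfAdjoint x → E x = E' x) (hE : IsClosedForm E) :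
    IsClosedForm E' := by
  intro u x hu hx hux hE0
  rw [← formDomain_congr h] at hu ⊢
  obtain ⟨h1, h2⟩ := hE u x hu hx hux
    (hE0.congr fun p => (h _ ((hu p.1).1.1.sub (hu p.2).1.1)).symm)
  exact ⟨h1, h2.congr fun k => h _ ((hu k).1.1.sub hx.1)⟩

/-- Every clause of the definition evaluates the form at self-adjoint operators only, which is where
`E ⊗ 1_m` and the form of the direct sum agree. -/
theorem IsDirichletForm.congr (h : ∀ x, IsSelfAdjoint x → E x = E' x) (hE : IsDirichletForm E) :
    IsDirichletForm E' where
  quadratic :=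
    { smul := fun x hx r => by
        have hr : IsSelfAdjoint ((r : ℂ) • x) :=
          IsSelfAdjoint.smul (Complex.conj_ofReal r) hx.1
        rw [← h x hx.1, ← h _ hr, hE.quadratic.smul x hx r]
      parallelogram := fun x hx y hy => by
        rw [← h _ (hx.1.add hy.1), ← h _ (hx.1.sub hy.1), ← h x hx.1, ← h y hy.1,
          hE.quadratic.parallelogram x hx y hy] }
  closed := hE.closed.congr h
  dense := by
    rw [← formDomain_congr h]
    exact hE.dense
  contraction := fun f C hf h0 x hx => by
    rw [← formDomain_congr h] at hx ⊢
    obtain ⟨h1, h2⟩ := hE.contraction f C hf h0 x hx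
    refine ⟨h1, ?_⟩
    rwa [← h x hx.1.1, ← h _ h1.1.1]

end congr

theorem isCompletelyDirichletForm_hsForm {S : H →ₗ.[ℂ] K} (hd : Dense (S.domain : Set H))
    (hS : IsClosedForm (hsForm S)) : IsCompletelyDirichletForm (hsForm S) := by
  intro m
  have h : ∀ x : AmplSpace H m →L[ℂ] AmplSpace H m, IsSelfAdjoint x →
      hsForm (amplOperator S m) x = amplForm (hsForm S) m x := fun x hx =>
    hsForm_amplOperator_eq_amplForm S hx
  refine (isDirichletForm_hsForm (dense_domain_amplOperator hd) ?_).congr h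
  exact (hS.amplForm m).congr fun x hx => (h x hx).symm

end amplification

/-! ### Closures of operators on smooth sections, and the conclusion. -/

theorem dense_domain_closedOperator {P Q : Type*} [AddCommGroup P] [Module ℂ P] [AddCommGroup Q]
    [Module ℂ Q] (c : PreInnerProductSpace.Core ℂ P) (d : PreInnerProductSpace.Core ℂ Q)
    (A : P →ₗ[ℂ] Q) : Dense ((closedOperator c d A).domain : Set (L2Completion P c)) := by
  refine (denseRange_toL2 c).mono ?_
  rintro _ ⟨s, rfl⟩
  -- The domain is the first projection of the closed graph whether or not `A` is closable, so it
  -- contains the dense image of `P`.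
  exact ⟨(toL2 c s, toL2 d (A s)), Submodule.le_topologicalClosure _ ⟨s, rfl⟩, rfl⟩

theorem mainTheorem8 :
    (∀ {n : ℕ} {X : Type*} [EMetricSpace X] [CompactSpace X] [MeasurableSpace X] [BorelSpace X]
      [ChartedSpace (EuclideanSpace ℝ (Fin n)) X] [IsManifold (𝓡 n) ∞ X]
      [RiemannianBundle (fun x : X => TangentSpace (𝓡 n) x)]
      [IsContMDiffRiemannianBundle (𝓡 n) ∞ (EuclideanSpace ℝ (Fin n))
        (fun x : X => TangentSpace (𝓡 n) x)]
      [IsRiemannianManifold (𝓡 n) X]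
      {F : Type*} [NormedAddCommGroup F] [NormedSpace ℂ F] [FiniteDimensional ℂ F]
      {V : X → Type*} [TopologicalSpace (TotalSpace F V)] [∀ x, NormedAddCommGroup (V x)]
      [∀ x, InnerProductSpace ℂ (V x)] [FiberBundle F V] [VectorBundle ℂ F V] [VectorBundle ℝ F V]
      [ContMDiffVectorBundle ∞ F V (𝓡 n)] [IsContMDiffRiemannianBundle (𝓡 n) ∞ F V]
      (cov : CovariantDerivative (𝓡 n) F V) (h : IsMetricConnection cov),
      (IsClosedForm (laplacianForm h) →
        IsDirichletForm (laplacianForm h) ∧ IsCompletelyDirichletForm (laplacianForm h)) ∧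
      ∀ (lc : CovariantDerivative (𝓡 n) (EuclideanSpace ℝ (Fin n))
          (fun x : X => TangentSpace (𝓡 n) x))
        (c : Π x : X, TangentSpace (𝓡 n) x →L[ℝ] V x →L[ℝ] V x) (hc : IsDiracBundle cov lc c),
        IsClosedForm (diracLaplacianForm h hc) →
          IsDirichletForm (diracLaplacianForm h hc) ∧
          IsCompletelyDirichletForm (diracLaplacianForm h hc)) ∧
    ∀ {H K : Type*} [NormedAddCommGroup H] [InnerProductSpace ℂ H] [CompleteSpace H]
      [NormedAddCommGroup K] [InnerProductSpace ℂ K] [CompleteSpace K] (S : H →ₗ.[ℂ] K),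
      Dense (S.domain : Set H) → IsClosedForm (hsForm S) →
        IsDirichletForm (hsForm S) ∧ IsCompletelyDirichletForm (hsForm S) := by
  refine ⟨fun cov h => ⟨fun hcl => ?_, fun lc c hc hcl => ?_⟩, fun S hd hcl => ?_⟩
  · have hd := dense_domain_closedOperator (sectionCore _ _ _) (oneFormCore _ _ _) (nabla h)
    exact ⟨isDirichletForm_hsForm hd hcl, isCompletelyDirichletForm_hsForm hd hcl⟩
  · have hd := dense_domain_closedOperator (sectionCore _ _ _) (sectionCore _ _ _) (dirac h hc)
    exact ⟨isDirichletForm_hsForm hd hcl, isCompletelyDirichletForm_hsForm hd hcl⟩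
  · exact ⟨isDirichletForm_hsForm hd hcl, isCompletelyDirichletForm_hsForm hd hcl⟩
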